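/- **Conventions.** $\hbar$ is a real formal parameter. An $\hbar$-adic module is a $\mathbb C[[\hbar]]$-module that is complete and separated in the $\hbar$-adic topology, $\hat\otimes$ is the completed tensor product over $\mathbb C[[\hbar]]$, and $[x]=(e^{\hbar x}-e^{-\hbar x})/(e^{\hbar}-e^{-\hbar})$, $[n]!=[1][2]\cdots[n]$. An action of an $\hbar$-adic algebra $A$ on $\mathcal X$ is extended by continuity to $A\hat\otimes A$: for a $\mathbb C[[\hbar]]$-bilinear multiplication $\mu$ on $\mathcal X$ the expression $\mu(T\triangleright[x\otimes y])$, $T\in A\hat\otimes A$, is the $\mathbb C[[\hbar]]$-linear extension of $(a\otimes b)\mapsto\mu((a\triangleright x)\otimes(b\triangleright y))$. $\mathcal U_\hbar(\mathrm{su}_2)$ is the $\hbar$-adic algebra generated by $E,H,F$ with relations $$[H,E]=2E,\qquad [H,F]=-2F,\qquad [E,F]=[H],$$ with $$\Delta(E)=E\otimes e^{\hbar H}+1\otimes E,\quad \Delta(F)=F\otimes 1+e^{-\hbar H}\otimes F,\quad \Delta(H)=H\otimes1+1\otimes H,$$ $$\varepsilon(E)=\varepsilon(F)=\varepsilon(H)=0,\qquad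 S(E)=-Ee^{-\hbar H},\quad S(F)=-e^{\hbar H}F,\quad S(H)=-H,$$ with the conjugate linear antihomomorphism $E^*=Fe^{\hbar H}$, $F^*=e^{-\hbar H}E$, $H^*=H$, and with the universal $\mathcal R$-matrix $$\mathcal R=e^{\hbar(H\otimes H)/2}\sum_{n\ge0}e^{\hbar n(n-1)/2}\,\frac{(e^{\hbar}-e^{-\hbar})^n}{[n]!}\,E^n\otimes F^n .$$ $\mathcal U_\hbar(\mathrm{so}_4)=\mathcal U_\hbar(\mathrm{su}_2)\hat\otimes\,\mathcal U_\hbar(\mathrm{su}_2)$ is the tensor product Hopf algebra, with coproduct $\Delta^{\otimes2}=\tau_{23}\circ(\Delta\otimes\Delta)$, counit $\varepsilon\otimes\varepsilon$ and antipode $S\otimes S$; its flipped $*$-structure is $(a\otimes b)^{*_\tau}=b^*\otimes a^*$. The quantum Lorentz algebra $\mathcal U_\hbar(\mathrm{sl}_2(\mathbb C))$ is the same algebra with the same counit and with $$\Delta(g)=\mathcal R_{23}^{-1}\Delta^{\otimes2}(g)\mathcal R_{23},\qquad S(a\otimes b)=\mathcal R_{21}(Sa\otimes Sb)\mathcal R_{21}^{-1},\qquad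 (a\otimes b)^*=\mathcal R_{21}(b^*\otimes a^*)\mathcal R_{21}^{-1},$$ where $\mathcal R_{23}=1\otimes\mathcal R\otimes1$ and $\mathcal R_{21}=\tau(\mathcal R)$. Let $(U,\Delta_0,\varepsilon_0)$ be the $\hbar$-adic completion of the enveloping algebra of a complex Lie algebra, with its undeformed coproduct and counit, let $U_\hbar$ be an $\hbar$-adic Hopf algebra with coproduct $\Delta$, and let $\alpha:U_\hbar\to U$ be an isomorphism of $\hbar$-adic algebras. A Drinfeld twist from $U$ to $U_\hbar$ (with respect to $\alpha$) is an invertible $\mathcal F\in U\hat\otimes U$ with $$(\alpha\otimes\alpha)\,\Delta(\alpha^{-1}(g))=\mathcal F\Delta_0(g)\mathcal F^{-1}\quad(g\in U),\qquad(\varepsilon_0\otimes\mathrm{id})(\mathcal F)=1=(\mathrm{id}\otimes\varepsilon_0)(\mathcal F).$$ The enveloping algebras $\mathcal U(\mathrm{so}_4)$ and $\mathcal U(\mathrm{sl}_2(\mathbb C))$ both have the Hopf algebra $\mathcal U(\mathrm{su}_2)\otimes\mathcal U(\mathrm{su}_2)$ underlying them, where $\mathcal U(\mathrm{su}_2)$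 is the enveloping algebra of the complexification $\mathfrak{sl}_2$ of $\mathrm{su}_2$. A module algebra of a Hopf algebra $A$ is an $\hbar$-adic $A$-module $\mathcal X$ with an associative $\mathbb C[[\hbar]]$-bilinear multiplication $\mu$ such that $g\triangleright\mu(x\otimes y)=\mu(\Delta(g)\triangleright[x\otimes y])$; it is unital if there is a two-sided unit $1$ with $g\triangleright1=\varepsilon(g)1$. A module $*$-algebra has in addition a conjugate linear involutive antihomomorphism $*$ of $(\mathcal X,\mu)$ with $(g\triangleright x)^*=(Sg)^*\triangleright x^*$. **Statement.** Let $\alpha',\alpha'':\mathcal U_\hbar(\mathrm{su}_2)\to\mathcal U(\mathrm{su}_2)[[\hbar]]$ be isomorphisms of $\hbar$-adic algebras (for instance $\alpha'=\alpha''$), and let $\mathcal F'$ and $\mathcal F''$ be Drinfeld twists from $\mathcal U(\mathrm{su}_2)$ to $\mathcal U_\hbar(\mathrm{su}_2)$ with respect to $\alpha'$ and $\alpha''$. Let $\mathcal X$ be an $\hbar$-adic $\mathcal U_\hbar(\mathrm{su}_2)\hat\otimes\,\mathcal U_\hbar(\mathrm{su}_2)$-module. (i) $\mathcal F'_{13}\mathcal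 F''_{24}$ is a Drinfeld twist from $\mathcal U(\mathrm{so}_4)$ to $\mathcal U_\hbar(\mathrm{so}_4)$ with respect to $\alpha'\otimes\alpha''$. (ii) $\mathcal R_{23}^{-1}\mathcal F'_{13}\mathcal F''_{24}$, where $\mathcal R_{23}$ stands for its image under $(\alpha'\otimes\alpha'')\otimes(\alpha'\otimes\alpha'')$, is a Drinfeld twist from $\mathcal U(\mathrm{sl}_2(\mathbb C))$ to $\mathcal U_\hbar(\mathrm{sl}_2(\mathbb C))$ with respect to $\alpha'\otimes\alpha''$. (iii) If $(\mathcal X,\mu)$ is a module algebra of $\mathcal U_\hbar(\mathrm{so}_4)$, then $(\mathcal X,\tilde\mu)$ with $\tilde\mu(x\otimes y):=\mu(\mathcal R_{23}\triangleright[x\otimes y])$ is a module algebra of $\mathcal U_\hbar(\mathrm{sl}_2(\mathbb C))$; if $(\mathcal X,\mu)$ is unital, then so is $(\mathcal X,\tilde\mu)$, with the same unit. (iv) If $(\mathcal X,\mu,*)$ is a module $*$-algebra of the Hopf algebra $\mathcal U_\hbar(\mathrm{so}_4)$ with the flipped $*$-structure $*_\tau$, then $(\mathcal X,\tilde\mu,*)$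 is a module $*$-algebra of $\mathcal U_\hbar(\mathrm{sl}_2(\mathbb C))$. -/

import Mathlib

noncomputable section

open scoped TensorProduct

namespace QLorentz

/-! ## Complete `ℂ⟦ħ⟧`-modules and completed algebras -/

/-- The ground ring `ℂ⟦ħ⟧`. -/
abbrev K : Type := PowerSeries ℂ

/-- The formal parameter `ħ`. -/
abbrev hbar : K := PowerSeries.X

/-- The ideal generated by `ħ`.  A `ℂ⟦ħ⟧`-module (or algebra) `M` is called `ħ`-adic if it is
complete and separated for the `ħ`-adic topology, that is, if `IsAdicComplete hbarIdeal M`. -/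
abbrev hbarIdeal : Ideal K := Ideal.span {hbar}

section Modules

variable {M : Type*} [AddCommGroup M] [Module K M]

theorem mem_pow_iff (n : ℕ) (x : M) :
    x ∈ (hbarIdeal ^ n • ⊤ : Submodule K M) ↔ ∃ y, x = hbar ^ n • y := by
  rw [Ideal.span_singleton_pow, Submodule.ideal_span_singleton_smul,
    Submodule.mem_smul_pointwise_iff_exists]
  simp [eq_comm]

theorem isHausdorff_iff_pow :
    IsHausdorff hbarIdeal M ↔ ∀ x : M, (∀ n : ℕ, ∃ y, x = hbar ^ n • y) → x = 0 := by
  simp only [isHausdorff_iff, SModEq.zero, mem_pow_iff]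

theorem isPrecomplete_iff_pow :
    IsPrecomplete hbarIdeal M ↔ ∀ f : ℕ → M, (∀ m n, m ≤ n → ∃ y, f m - f n = hbar ^ m • y) →
      ∃ L : M, ∀ n, ∃ y, f n - L = hbar ^ n • y := by
  simp only [isPrecomplete_iff, SModEq.sub_mem, mem_pow_iff]

theorem eq_of_forall_pow [IsAdicComplete hbarIdeal M] {x y : M}
    (h : ∀ n : ℕ, ∃ z, x - y = hbar ^ n • z) : x = y :=
  sub_eq_zero.1 (isHausdorff_iff_pow.1 inferInstance _ h)

theorem hsum_exists [IsAdicComplete hbarIdeal M] (a : ℕ → M) :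
    ∃ s : M, ∀ n, ∃ y, (∑ i ∈ Finset.range n, hbar ^ i • a i) - s = hbar ^ n • y := by
  refine isPrecomplete_iff_pow.1 inferInstance _ fun m n hmn => ?_
  obtain ⟨k, rfl⟩ := Nat.exists_eq_add_of_le hmn
  refine ⟨-∑ i ∈ Finset.range k, hbar ^ i • a (m + i), ?_⟩
  rw [Finset.sum_range_add, smul_neg, Finset.smul_sum]
  simp [pow_add, mul_smul]

/-- The sum `∑ₙ ħⁿ aₙ` in an `ħ`-adic module, as limit of its partial sums. -/
def hsum [IsAdicComplete hbarIdeal M] (a : ℕ → M) : M := (hsum_exists a).choose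

theorem hsum_spec [IsAdicComplete hbarIdeal M] (a : ℕ → M) (n : ℕ) :
    ∃ y, (∑ i ∈ Finset.range n, hbar ^ i • a i) - hsum a = hbar ^ n • y :=
  (hsum_exists a).choose_spec n

theorem hsum_unique [IsAdicComplete hbarIdeal M] {a : ℕ → M} {s : M}
    (h : ∀ n, ∃ y, (∑ i ∈ Finset.range n, hbar ^ i • a i) - s = hbar ^ n • y) : hsum a = s := by
  refine eq_of_forall_pow fun n => ?_
  obtain ⟨y, hy⟩ := h n
  obtain ⟨z, hz⟩ := hsum_spec a n
  exact ⟨y - z, by rw [smul_sub, ← hy, ← hz]; abel⟩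

theorem hsum_succ [IsAdicComplete hbarIdeal M] (a : ℕ → M) :
    hsum a = a 0 + hbar • hsum (fun n => a (n + 1)) := by
  refine hsum_unique fun n => ?_
  rcases n with _ | n
  · exact ⟨_, (one_smul _ _).symm.trans (by rw [pow_zero])⟩
  · obtain ⟨y, hy⟩ := hsum_spec (fun n => a (n + 1)) n
    refine ⟨y, ?_⟩
    rw [Finset.sum_range_succ', pow_succ', mul_smul, ← hy, smul_sub, Finset.smul_sum]
    simp only [pow_succ', mul_smul, pow_zero, one_smul]
    abel

variable {N : Type*} [AddCommGroup N] [Module K N]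

theorem map_hsum [IsAdicComplete hbarIdeal M] [IsAdicComplete hbarIdeal N] (f : M →ₗ[K] N)
    (a : ℕ → M) : f (hsum a) = hsum (fun n => f (a n)) := by
  refine (hsum_unique fun n => ?_).symm
  obtain ⟨y, hy⟩ := hsum_spec a n
  exact ⟨f y, by rw [← map_smul f, ← hy]; simp⟩

/-- Completeness is transported by additive bijections that commute with `ħ`. -/
theorem complete_of_addEquiv [IsAdicComplete hbarIdeal M] (e : M ≃+ N)
    (h : ∀ x, e (hbar • x) = hbar • e x) : IsAdicComplete hbarIdeal N := by
  have hpow (n : ℕ) (x : M) : e (hbar ^ n • x) = hbar ^ n • e x := by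
    induction n generalizing x with
    | zero => simp
    | succ n ih => rw [pow_succ, mul_smul, ih, h, ← mul_smul]
  have hsymm (n : ℕ) (x y : N) (hxy : x = hbar ^ n • y) :
      e.symm x = hbar ^ n • e.symm y := by
    rw [e.symm_apply_eq, hpow, e.apply_symm_apply, hxy]
  have h1 : IsHausdorff hbarIdeal N := by
    refine isHausdorff_iff_pow.2 fun x hx => ?_
    rw [← e.symm.map_eq_zero_iff]
    exact isHausdorff_iff_pow.1 inferInstance _ fun n => ⟨_, hsymm n x _ (hx n).choose_spec⟩
  have h2 : IsPrecomplete hbarIdeal N := by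
    refine isPrecomplete_iff_pow.2 fun f hf => ?_
    obtain ⟨L, hL⟩ := isPrecomplete_iff_pow.1 (inferInstance : IsPrecomplete hbarIdeal M)
      (fun n => e.symm (f n)) fun m n hmn => by
        obtain ⟨y, hy⟩ := hf m n hmn
        exact ⟨_, by rw [← map_sub]; exact hsymm m _ y hy⟩
    refine ⟨e L, fun n => ?_⟩
    obtain ⟨y, hy⟩ := hL n
    refine ⟨e y, ?_⟩
    rw [← hpow, ← hy, map_sub, e.apply_symm_apply]
  exact { }

/-- The `ħ`-adic completion `lim_n M / ħⁿM` of a `ℂ⟦ħ⟧`-module. -/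
def HC (M : Type*) [AddCommGroup M] [Module K M] : Type _ := AdicCompletion hbarIdeal M

namespace HC

instance : AddCommGroup (HC M) := inferInstanceAs (AddCommGroup (AdicCompletion hbarIdeal M))
instance : Module K (HC M) := inferInstanceAs (Module K (AdicCompletion hbarIdeal M))
instance instComplete : IsAdicComplete hbarIdeal (HC M) :=
  AdicCompletion.isAdicComplete ⟨{hbar}, by simp⟩

/-- The canonical map from a module into its completion. -/
def ofL : M →ₗ[K] HC M := AdicCompletion.of hbarIdeal M

/-- The extension of a linear map into an `ħ`-adic module to the completion. -/
def extend [IsAdicComplete hbarIdeal N] (f : M →ₗ[K] N) : HC M →ₗ[K] N :=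
  let g : AdicCompletion hbarIdeal M →ₗ[K] N :=
    (AdicCompletion.ofLinearEquiv hbarIdeal N).symm.toLinearMap ∘ₗ
      LinearMap.restrictScalars K (AdicCompletion.map hbarIdeal f)
  g

theorem extend_of [IsAdicComplete hbarIdeal N] (f : M →ₗ[K] N) (x : M) :
    extend f (ofL x) = f x := by
  have h : (AdicCompletion.ofLinearEquiv hbarIdeal N).symm
      (AdicCompletion.map hbarIdeal f (AdicCompletion.of hbarIdeal M x)) = f x := by
    rw [AdicCompletion.map_of, AdicCompletion.ofLinearEquiv_symm_of]
  exact h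

attribute [irreducible] extend

theorem exists_approx (x : HC M) (n : ℕ) : ∃ a : M, ∃ y, x - ofL a = hbar ^ n • y := by
  have key : ∀ x : AdicCompletion hbarIdeal M, ∃ a : M,
      x - AdicCompletion.of hbarIdeal M a ∈
        (hbarIdeal ^ n • ⊤ : Submodule K (AdicCompletion hbarIdeal M)) := by
    intro x
    obtain ⟨a, ha⟩ := Submodule.Quotient.mk_surjective _ (x.1 n)
    refine ⟨a, ?_⟩
    rw [AdicCompletion.pow_smul_top_eq_ker_eval ⟨{hbar}, by simp⟩, LinearMap.mem_ker, map_sub,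
      AdicCompletion.eval_of, AdicCompletion.eval_apply, ← ha, Submodule.mkQ_apply, sub_self]
  obtain ⟨a, ha⟩ := key x
  exact ⟨a, (mem_pow_iff n _).1 ha⟩

/-- Two linear maps into an `ħ`-adic module which agree on `M` agree on its completion. -/
theorem hom_ext [IsAdicComplete hbarIdeal N] {f g : HC M →ₗ[K] N}
    (h : ∀ x : M, f (ofL x) = g (ofL x)) : f = g := by
  ext x
  refine eq_of_forall_pow fun n => ?_
  obtain ⟨a, y, hy⟩ := exists_approx x n
  refine ⟨f y - g y, ?_⟩
  rw [smul_sub, ← map_smul f, ← map_smul g, ← hy, map_sub, map_sub, h]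
  abel

theorem ext_apply [IsAdicComplete hbarIdeal N] (f g : HC M →ₗ[K] N)
    (h : ∀ x : M, f (ofL x) = g (ofL x)) (x : HC M) : f x = g x := by rw [hom_ext h]

end HC

end Modules

/-! ### The ring structure of a completed algebra -/

namespace HC

variable {A : Type*} [Ring A] [Algebra K A]

/-- Right multiplication by an element of `A` on the completion of `A`. -/
def mulRightOf (b : A) : HC A →ₗ[K] HC A := extend (ofL ∘ₗ LinearMap.mulRight K b)

theorem mulRightOf_of (a b : A) : mulRightOf b (ofL a) = ofL (a * b) := extend_of _ _

/-- Right multiplication, as a linear map `A → End (HC A)`. -/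
def mulRightL : A →ₗ[K] HC A →ₗ[K] HC A where
  toFun := mulRightOf
  map_add' := fun a b => hom_ext fun x => by
    simp only [LinearMap.add_apply, mulRightOf_of, mul_add, map_add]
  map_smul' := fun c b => hom_ext fun x => by
    simp only [LinearMap.smul_apply, mulRightOf_of, mul_smul_comm, map_smul, RingHom.id_apply]

/-- The continuous bilinear extension of the multiplication of `A` to its completion. -/
def mulB : HC A →ₗ[K] HC A →ₗ[K] HC A where
  toFun := fun x => extend ((mulRightL (A := A)).flip x)
  map_add' := fun x y => hom_ext fun b => by simp only [LinearMap.add_apply, extend_of, map_add]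
  map_smul' := fun c x => hom_ext fun b => by
    simp only [LinearMap.smul_apply, extend_of, map_smul, RingHom.id_apply]

theorem mulB_of (a b : A) : mulB (ofL a) (ofL b) = ofL (a * b) :=
  (extend_of ((mulRightL (A := A)).flip (ofL a)) b).trans (mulRightOf_of a b)

attribute [irreducible] mulB

theorem mulB_assoc (x y z : HC A) : mulB (mulB x y) z = mulB x (mulB y z) := by
  have h1 (a b : A) (z : HC A) : mulB (mulB (ofL a) (ofL b)) z = mulB (ofL a) (mulB (ofL b) z) :=
    ext_apply (mulB (mulB (ofL a) (ofL b))) (mulB (ofL a) ∘ₗ mulB (ofL b))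
      (fun c => by simp only [LinearMap.comp_apply, mulB_of, mul_assoc]) z
  have h2 (a : A) (y z : HC A) : mulB (mulB (ofL a) y) z = mulB (ofL a) (mulB y z) :=
    ext_apply (mulB.flip z ∘ₗ mulB (ofL a)) (mulB (ofL a) ∘ₗ mulB.flip z) (fun b => h1 a b z) y
  exact ext_apply (mulB.flip z ∘ₗ mulB.flip y) (mulB.flip (mulB y z)) (fun a => h2 a y z) x

theorem mulB_one_left (x : HC A) : mulB (ofL 1) x = x :=
  ext_apply (mulB (ofL (1 : A))) LinearMap.id
    (fun a => (mulB_of 1 a).trans (congrArg ofL (one_mul a))) x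

theorem mulB_one_right (x : HC A) : mulB x (ofL 1) = x :=
  ext_apply (mulB.flip (ofL (1 : A))) LinearMap.id
    (fun a => (mulB_of a 1).trans (congrArg ofL (mul_one a))) x

/-- The ring structure of the completion of an algebra `A`: its multiplication is the continuous
extension of the multiplication of `A`. -/
instance instRing : Ring (HC A) :=
  { (inferInstance : AddCommGroup (HC A)) with
    mul := fun x y => mulB x y
    one := ofL (1 : A)
    left_distrib := fun x y z => map_add (mulB x) y z
    right_distrib := fun x y z => LinearMap.map_add₂ mulB x y z
    zero_mul := fun x => LinearMap.map_zero₂ mulB x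
    mul_zero := fun x => map_zero (mulB x)
    mul_assoc := mulB_assoc
    one_mul := mulB_one_left
    mul_one := mulB_one_right }

theorem mul_def (x y : HC A) : x * y = mulB x y := rfl

instance instAlgebra : Algebra K (HC A) :=
  Algebra.ofModule (fun c x y => LinearMap.map_smul₂ mulB c x y)
    (fun c x y => map_smul (mulB x) c y)

/-- Completed `ℂ⟦ħ⟧`-algebras are `ℂ`-algebras. -/
instance : Algebra ℂ (HC A) := Algebra.compHom (HC A) (algebraMap ℂ K)

instance : IsScalarTower ℂ K (HC A) := IsScalarTower.of_algebraMap_eq fun _ => rfl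

/-- The canonical homomorphism from an algebra to its completion. -/
def of : A →ₐ[K] HC A := AlgHom.ofLinearMap ofL rfl (fun a b => (mulB_of a b).symm)

theorem of_apply (a : A) : of a = ofL a := rfl

variable {B : Type*} [Ring B] [Algebra K B] [IsAdicComplete hbarIdeal B]

/-- An algebra homomorphism into an `ħ`-adic algebra extends to the completion. -/
def lift (f : A →ₐ[K] B) : HC A →ₐ[K] B :=
  AlgHom.ofLinearMap (extend f.toLinearMap)
    ((extend_of _ (1 : A)).trans (map_one f))
    (by
      have h1 (a : A) (y : HC A) : extend f.toLinearMap (ofL a * y) =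
          f a * extend f.toLinearMap y :=
        ext_apply (extend f.toLinearMap ∘ₗ mulB (ofL a))
          (LinearMap.mulLeft K (f a) ∘ₗ extend f.toLinearMap)
          (fun b => by
            simp only [LinearMap.comp_apply, mulB_of, extend_of, LinearMap.mulLeft_apply,
              AlgHom.toLinearMap_apply, map_mul]) y
      intro x y
      exact ext_apply (extend f.toLinearMap ∘ₗ mulB.flip y)
          (LinearMap.mulRight K (extend f.toLinearMap y) ∘ₗ extend f.toLinearMap)
          (fun a => by
            simp only [LinearMap.comp_apply, LinearMap.mulRight_apply, extend_of,
              AlgHom.toLinearMap_apply]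
            exact h1 a y) x)

@[simp] theorem lift_of (f : A →ₐ[K] B) (a : A) : lift f (of a) = f a :=
  extend_of f.toLinearMap a

theorem algHom_ext {f g : HC A →ₐ[K] B} (h : ∀ a, f (of a) = g (of a)) : f = g :=
  AlgHom.toLinearMap_injective (hom_ext h)


theorem commute_of {f : HC A →ₐ[K] B} {c : B} (h : ∀ a, Commute (f (of a)) c) (x : HC A) :
    Commute (f x) c :=
  ext_apply (LinearMap.mulRight K c ∘ₗ f.toLinearMap) (LinearMap.mulLeft K c ∘ₗ f.toLinearMap)
    (fun a => h a) x

attribute [irreducible] lift of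

end HC

/-! ### Completed tensor products of algebras -/

/-- The completed tensor product `A ⊗̂ B` of `ℂ⟦ħ⟧`-algebras, the `ħ`-adic completion of `A ⊗ B`
(wrapped in a structure, with the transported ring structure). -/
structure CT (A B : Type*) [Ring A] [Algebra K A] [Ring B] [Algebra K B] where
  /-- The underlying element of the completion. -/
  val : HC (A ⊗[K] B)

namespace CT

section Instances

variable (A B : Type*) [Ring A] [Algebra K A] [Ring B] [Algebra K B]

/-- Unwrapping. -/
def equiv : CT A B ≃ HC (A ⊗[K] B) := ⟨val, mk, fun _ => rfl, fun _ => rfl⟩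

instance : Ring (CT A B) := (equiv A B).ring
instance : Algebra K (CT A B) := (equiv A B).algebra K
instance : Algebra ℂ (CT A B) := Algebra.compHom (CT A B) (algebraMap ℂ K)
instance : IsScalarTower ℂ K (CT A B) := IsScalarTower.of_algebraMap_eq fun _ => rfl

/-- Unwrapping, as an isomorphism of algebras. -/
def algEquiv : CT A B ≃ₐ[K] HC (A ⊗[K] B) := (equiv A B).algEquiv K

instance : IsAdicComplete hbarIdeal (CT A B) :=
  complete_of_addEquiv (algEquiv A B).symm.toAddEquiv fun x => map_smul (algEquiv A B).symm hbar x

end Instances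

variable {A B C D : Type*} [Ring A] [Algebra K A] [Ring B] [Algebra K B] [Ring C] [Algebra K C]
  [Ring D] [Algebra K D]

/-- The canonical map from the algebraic to the completed tensor product. -/
def of : A ⊗[K] B →ₐ[K] CT A B := (algEquiv A B).symm.toAlgHom.comp HC.of

/-- The extension of a linear map from `A ⊗ B` to the completed tensor product. -/
def extend {N : Type*} [AddCommGroup N] [Module K N] [IsAdicComplete hbarIdeal N]
    (f : A ⊗[K] B →ₗ[K] N) : CT A B →ₗ[K] N := HC.extend f ∘ₗ (algEquiv A B).toLinearMap

theorem extend_of {N : Type*} [AddCommGroup N] [Module K N] [IsAdicComplete hbarIdeal N]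
    (f : A ⊗[K] B →ₗ[K] N) (t : A ⊗[K] B) : extend f (of t) = f t := by
  rw [extend, LinearMap.comp_apply, of, AlgHom.comp_apply]
  refine (congrArg _ ((algEquiv A B).apply_symm_apply (HC.of t))).trans ?_
  rw [HC.of_apply, HC.extend_of]

theorem hom_ext {N : Type*} [AddCommGroup N] [Module K N] [IsAdicComplete hbarIdeal N]
    {f g : CT A B →ₗ[K] N} (h : ∀ a b, f (of (a ⊗ₜ b)) = g (of (a ⊗ₜ b))) : f = g := by
  have h1 : f ∘ₗ (of (A := A) (B := B)).toLinearMap = g ∘ₗ (of (A := A) (B := B)).toLinearMap :=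
    TensorProduct.ext' fun a b => h a b
  have h2 : f ∘ₗ (algEquiv A B).symm.toLinearMap = g ∘ₗ (algEquiv A B).symm.toLinearMap :=
    HC.hom_ext fun t => by rw [← HC.of_apply]; exact LinearMap.congr_fun h1 t
  ext x
  have h3 := LinearMap.congr_fun h2 (algEquiv A B x)
  simpa using h3

/-- `a ↦ a ⊗ 1`. -/
def inl : A →ₐ[K] CT A B := of.comp Algebra.TensorProduct.includeLeft

/-- `b ↦ 1 ⊗ b`. -/
def inr : B →ₐ[K] CT A B := of.comp Algebra.TensorProduct.includeRight

theorem inl_apply (a : A) : (inl a : CT A B) = of (a ⊗ₜ 1) := rfl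

theorem inr_apply (b : B) : (inr b : CT A B) = of (1 ⊗ₜ b) := rfl

attribute [irreducible] inl inr

theorem inl_mul_inr (a : A) (b : B) : (inl a * inr b : CT A B) = of (a ⊗ₜ b) := by
  rw [inl_apply, inr_apply, ← map_mul, Algebra.TensorProduct.tmul_mul_tmul, one_mul, mul_one]

theorem inl_commute_inr (a : A) (b : B) : Commute (inl a : CT A B) (inr b) := by
  unfold Commute SemiconjBy
  rw [inl_mul_inr, inl_apply, inr_apply, ← map_mul, Algebra.TensorProduct.tmul_mul_tmul, one_mul,
    mul_one]

/-- Homomorphisms `f`, `g` into an `ħ`-adic algebra with commuting images define the homomorphism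
`a ⊗ b ↦ f a * g b` on the completed tensor product. -/
def lift [IsAdicComplete hbarIdeal C] (f : A →ₐ[K] C) (g : B →ₐ[K] C)
    (h : ∀ a b, Commute (f a) (g b)) : CT A B →ₐ[K] C :=
  (HC.lift (Algebra.TensorProduct.lift f g h)).comp (algEquiv A B).toAlgHom

theorem lift_of [IsAdicComplete hbarIdeal C] (f : A →ₐ[K] C) (g : B →ₐ[K] C)
    (h : ∀ a b, Commute (f a) (g b)) (t : A ⊗[K] B) :
    lift f g h (of t) = Algebra.TensorProduct.lift f g h t := by
  rw [lift, of, AlgHom.comp_apply, AlgHom.comp_apply]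
  exact (congrArg _ ((algEquiv A B).apply_symm_apply (HC.of t))).trans (HC.lift_of _ t)

attribute [irreducible] lift of

@[simp] theorem lift_inl [IsAdicComplete hbarIdeal C] (f : A →ₐ[K] C) (g : B →ₐ[K] C)
    (h : ∀ a b, Commute (f a) (g b)) (a : A) : lift f g h (inl a) = f a := by
  rw [inl_apply, lift_of, Algebra.TensorProduct.lift_tmul, map_one, mul_one]

@[simp] theorem lift_inr [IsAdicComplete hbarIdeal C] (f : A →ₐ[K] C) (g : B →ₐ[K] C)
    (h : ∀ a b, Commute (f a) (g b)) (b : B) : lift f g h (inr b) = g b := by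
  rw [inr_apply, lift_of, Algebra.TensorProduct.lift_tmul, map_one, one_mul]

theorem algHom_ext [IsAdicComplete hbarIdeal C] {f g : CT A B →ₐ[K] C}
    (h1 : ∀ a, f (inl a) = g (inl a)) (h2 : ∀ b, f (inr b) = g (inr b)) : f = g := by
  refine AlgHom.toLinearMap_injective (hom_ext fun a b => ?_)
  rw [AlgHom.toLinearMap_apply, AlgHom.toLinearMap_apply, ← inl_mul_inr, map_mul, map_mul, h1, h2]

theorem commute_of [IsAdicComplete hbarIdeal C] {f : CT A B →ₐ[K] C} {c : C}
    (h1 : ∀ a, Commute (f (inl a)) c) (h2 : ∀ b, Commute (f (inr b)) c) (x : CT A B) :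
    Commute (f x) c := by
  have h : LinearMap.mulRight K c ∘ₗ f.toLinearMap = LinearMap.mulLeft K c ∘ₗ f.toLinearMap := by
    refine hom_ext fun a b => ?_
    simp only [LinearMap.comp_apply, AlgHom.toLinearMap_apply, LinearMap.mulRight_apply,
      LinearMap.mulLeft_apply]
    rw [← inl_mul_inr, map_mul]
    exact (h1 a).mul_left (h2 b)
  exact LinearMap.congr_fun h x

/-- `f ⊗ g` on completed tensor products. -/
def map (f : A →ₐ[K] C) (g : B →ₐ[K] D) : CT A B →ₐ[K] CT C D :=
  lift (inl.comp f) (inr.comp g) fun a b => by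
    rw [AlgHom.comp_apply, AlgHom.comp_apply]; exact inl_commute_inr _ _

@[simp] theorem map_inl (f : A →ₐ[K] C) (g : B →ₐ[K] D) (a : A) :
    map f g (inl a) = inl (f a) := by
  rw [map, lift_inl, AlgHom.comp_apply]

@[simp] theorem map_inr (f : A →ₐ[K] C) (g : B →ₐ[K] D) (b : B) :
    map f g (inr b) = inr (g b) := by
  rw [map, lift_inr, AlgHom.comp_apply]

/-- `f ⊗ g` for isomorphisms `f`, `g`. -/
def congr (f : A ≃ₐ[K] C) (g : B ≃ₐ[K] D) : CT A B ≃ₐ[K] CT C D :=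
  AlgEquiv.ofAlgHom (map f.toAlgHom g.toAlgHom) (map f.symm.toAlgHom g.symm.toAlgHom)
    (algHom_ext (by simp) (by simp)) (algHom_ext (by simp) (by simp))

/-- `x ↦ x₁₃`, from `A ⊗̂ A` to `(A ⊗̂ B) ⊗̂ (A ⊗̂ B)`. -/
def leg13 : CT A A →ₐ[K] CT (CT A B) (CT A B) := map inl inl

/-- `x ↦ x₂₄`, from `B ⊗̂ B` to `(A ⊗̂ B) ⊗̂ (A ⊗̂ B)`. -/
def leg24 : CT B B →ₐ[K] CT (CT A B) (CT A B) := map inr inr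

/-- `x ↦ x₂₃ = 1 ⊗ x ⊗ 1`, from `B ⊗̂ A` to `(A ⊗̂ B) ⊗̂ (A ⊗̂ B)`. -/
def leg23 : CT B A →ₐ[K] CT (CT A B) (CT A B) := map inr inl

/-- The flip `a ⊗ b ↦ b ⊗ a`. -/
def flip : CT A B →ₐ[K] CT B A := lift inr inl fun a b => (inl_commute_inr b a).symm

theorem leg13_commute_leg24 (x : CT A A) (y : CT B B) :
    Commute (leg13 x : CT (CT A B) (CT A B)) (leg24 y) := by
  have hl (a : A) (y : CT B B) :
      Commute (leg24 y : CT (CT A B) (CT A B)) (inl (inl a)) := by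
    refine commute_of (fun b => ?_) (fun b => ?_) y
    · rw [leg24, map_inl]; exact (inl_commute_inr a b).symm.map inl
    · rw [leg24, map_inr]; exact (inl_commute_inr _ _).symm
  have hr (a : A) (y : CT B B) :
      Commute (leg24 y : CT (CT A B) (CT A B)) (inr (inl a)) := by
    refine commute_of (fun b => ?_) (fun b => ?_) y
    · rw [leg24, map_inl]; exact inl_commute_inr _ _
    · rw [leg24, map_inr]; exact (inl_commute_inr a b).symm.map inr
  refine commute_of (fun a => ?_) (fun a => ?_) x
  · rw [leg13, map_inl]; exact (hl a y).symm
  · rw [leg13, map_inr]; exact (hr a y).symm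

/-- The tensor product coproduct `τ₂₃ ∘ (Δ_A ⊗ Δ_B)` on `A ⊗̂ B`. -/
def comul (ΔA : A →ₐ[K] CT A A) (ΔB : B →ₐ[K] CT B B) :
    CT A B →ₐ[K] CT (CT A B) (CT A B) :=
  lift (leg13.comp ΔA) (leg24.comp ΔB) fun a b => by
    rw [AlgHom.comp_apply, AlgHom.comp_apply]; exact leg13_commute_leg24 _ _

/-- The tensor product counit `ε_A ⊗ ε_B` on `A ⊗̂ B`. -/
def counit (εA : A →ₐ[K] K) (εB : B →ₐ[K] K) : CT A B →ₐ[K] K :=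
  lift εA εB fun _ _ => Commute.all _ _

end CT

/-! ### Exponentials and quantum numbers -/

section Terms

variable {A B : Type*} [Ring A] [Algebra K A] [Ring B] [Algebra K B]

/-- `1 / n!`. -/
def invFact (n : ℕ) : K := algebraMap ℂ K (n.factorial : ℂ)⁻¹

theorem invFact_zero : invFact 0 = 1 := by simp [invFact]

/-- The `n`-th term `xⁿ / n!` of the exponential series. -/
def expTerm (n : ℕ) (x : A) : A := invFact n • x ^ n

theorem expTerm_add {x y : A} (h : Commute x y) (n : ℕ) :
    expTerm n (x + y) = ∑ p ∈ Finset.HasAntidiagonal.antidiagonal n, expTerm p.1 x * expTerm p.2 y := by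
  unfold expTerm
  rw [h.add_pow', Finset.smul_sum]
  refine Finset.sum_congr rfl fun p hp => ?_
  rw [smul_mul_smul_comm, ← Nat.cast_smul_eq_nsmul K, smul_smul]
  congr 1
  obtain rfl := Finset.HasAntidiagonal.mem_antidiagonal.1 hp
  have hc : ((p.1 + p.2).factorial : ℂ)⁻¹ * ((p.1 + p.2).choose p.1 : ℂ) =
      (p.1.factorial : ℂ)⁻¹ * (p.2.factorial : ℂ)⁻¹ := by
    rw [Nat.cast_add_choose ℂ]
    have h1 : ((p.1 + p.2).factorial : ℂ) ≠ 0 := by exact_mod_cast Nat.factorial_ne_zero _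
    field_simp
  have := congrArg (algebraMap ℂ K) hc
  simpa [invFact] using this

theorem map_expTerm (f : A →ₐ[K] B) (n : ℕ) (x : A) : f (expTerm n x) = expTerm n (f x) := by
  simp only [expTerm, map_smul, map_pow]

end Terms

section Series

variable {M N : Type*} [AddCommGroup M] [Module K M] [IsAdicComplete hbarIdeal M]
  [AddCommGroup N] [Module K N] [IsAdicComplete hbarIdeal N]

theorem addMap_hsum (f : M →+ N) (hf : ∀ x, f (hbar • x) = hbar • f x) (a : ℕ → M) :
    f (hsum a) = hsum (fun n => f (a n)) := by
  have hpow (n : ℕ) (x : M) : f (hbar ^ n • x) = hbar ^ n • f x := by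
    induction n generalizing x with
    | zero => simp
    | succ n ih => rw [pow_succ, mul_smul, ih, hf, ← mul_smul]
  refine (hsum_unique fun n => ?_).symm
  obtain ⟨y, hy⟩ := hsum_spec a n
  exact ⟨f y, by rw [← hpow, ← hy, map_sub, map_sum]; simp only [hpow]⟩

theorem hsum_add (a b : ℕ → M) : hsum (fun n => a n + b n) = hsum a + hsum b := by
  refine hsum_unique fun n => ?_
  obtain ⟨y, hy⟩ := hsum_spec a n
  obtain ⟨z, hz⟩ := hsum_spec b n
  refine ⟨y + z, ?_⟩
  rw [smul_add, ← hy, ← hz]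
  simp only [smul_add, Finset.sum_add_distrib]
  abel

theorem hsum_neg (a : ℕ → M) : hsum (fun n => -a n) = -hsum a :=
  (map_hsum (-LinearMap.id : M →ₗ[K] M) a).symm

variable {A B : Type*} [Ring A] [Algebra K A] [IsAdicComplete hbarIdeal A]
  [Ring B] [Algebra K B] [IsAdicComplete hbarIdeal B]

theorem hsum_mul_hsum (a b : ℕ → A) :
    hsum a * hsum b = hsum fun n => ∑ p ∈ Finset.HasAntidiagonal.antidiagonal n, a p.1 * b p.2 := by
  refine (hsum_unique fun n => ?_).symm
  induction n generalizing a with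
  | zero => exact ⟨_, (one_smul _ _).symm.trans (by rw [pow_zero])⟩
  | succ n ih =>
    obtain ⟨y, hy⟩ := ih fun k => a (k + 1)
    obtain ⟨z, hz⟩ := hsum_spec b (n + 1)
    refine ⟨a 0 * z + y, ?_⟩
    rw [smul_add, ← mul_smul_comm, ← hz, pow_succ' hbar n, mul_smul, ← hy, hsum_succ a,
      Finset.sum_range_succ', Finset.sum_range_succ' (fun i => hbar ^ i • b i)]
    simp only [Finset.Nat.antidiagonal_succ, Finset.sum_cons, Finset.sum_map, smul_add,
      Finset.sum_add_distrib, Function.Embedding.prodMap, Function.Embedding.coeFn_mk, Prod.map,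
      Function.Embedding.refl_apply, Nat.succ_eq_add_one, Finset.Nat.antidiagonal_zero,
      Finset.sum_singleton, pow_zero, one_smul, mul_sub, mul_add, add_mul, Finset.mul_sum,
      mul_smul_comm, smul_mul_assoc, smul_sub, Finset.smul_sum, pow_succ', mul_smul]
    abel

theorem isUnit_one_add_hbar (y : A) : IsUnit (1 + hbar • y) := by
  have h : hsum (fun n => (-y) ^ n) = 1 + hbar • hsum (fun n => (-y) ^ (n + 1)) := by
    rw [hsum_succ, pow_zero]
  have h1 : hsum (fun n => (-y) ^ (n + 1)) = -y * hsum (fun n => (-y) ^ n) := by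
    rw [← LinearMap.mulLeft_apply K, map_hsum]
    simp only [LinearMap.mulLeft_apply, pow_succ']
  have h2 : hsum (fun n => (-y) ^ (n + 1)) = hsum (fun n => (-y) ^ n) * -y := by
    rw [← LinearMap.mulRight_apply K, map_hsum]
    simp only [LinearMap.mulRight_apply, pow_succ]
  refine ⟨⟨_, hsum (fun n => (-y) ^ n), ?_, ?_⟩, rfl⟩
  · rw [add_mul, one_mul, smul_mul_assoc]
    nth_rw 1 [h]
    rw [h1, neg_mul, smul_neg]
    abel
  · rw [mul_add, mul_one, mul_smul_comm]
    nth_rw 1 [h]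
    rw [h2, mul_neg, smul_neg]
    abel

theorem isUnit_hsum {a : ℕ → A} (h : a 0 = 1) : IsUnit (hsum a) := by
  rw [hsum_succ, h]
  exact isUnit_one_add_hbar _

/-- The exponential `e^{ħx} = ∑ₙ ħⁿ xⁿ / n!`. -/
def hexp (x : A) : A := hsum fun n => expTerm n x

/-- The series `(e^{ħx} - e^{-ħx}) / ħ = ∑ₙ ħⁿ (xⁿ⁺¹ - (-x)ⁿ⁺¹) / (n+1)!`. -/
def hsinh (x : A) : A := hsum fun n => expTerm (n + 1) x - expTerm (n + 1) (-x)

/-- The quantum number `[x] = (e^{ħx} - e^{-ħx}) / (e^ħ - e^{-ħ})`. -/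
def qnum (x : A) : A := (hsinh (1 : K))⁻¹ • hsinh x

theorem hbar_smul_hsinh (x : A) : hbar • hsinh x = hexp x - hexp (-x) := by
  unfold hexp hsinh
  rw [sub_eq_add_neg, ← hsum_neg, ← hsum_add,
    hsum_succ (fun n => expTerm n x + -expTerm n (-x))]
  simp only [expTerm, pow_zero, add_neg_cancel, zero_add, sub_eq_add_neg]

theorem constantCoeff_hsinh_one : PowerSeries.constantCoeff (hsinh (1 : K)) = 2 := by
  unfold hsinh
  rw [hsum_succ]
  simp [expTerm, invFact]
  norm_num

theorem hsinh_mul_inv : hsinh (1 : K) * (hsinh (1 : K))⁻¹ = 1 :=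
  PowerSeries.mul_inv_cancel _ (by rw [constantCoeff_hsinh_one]; norm_num)

/-- The defining property of the quantum numbers. -/
theorem qnum_spec (x : A) :
    (hexp (1 : K) - hexp (-1 : K)) • qnum x = hexp x - hexp (-x) := by
  rw [← hbar_smul_hsinh, ← hbar_smul_hsinh, qnum, smul_smul, smul_eq_mul, mul_assoc, hsinh_mul_inv,
    mul_one]

theorem hexp_zero : hexp (0 : A) = 1 := by
  refine hsum_unique fun n => ?_
  rcases n with _ | n
  · exact ⟨-1, by simp⟩
  · refine ⟨0, ?_⟩
    rw [Finset.sum_range_succ']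
    simp [expTerm, invFact_zero]

theorem hexp_add {x y : A} (h : Commute x y) : hexp (x + y) = hexp x * hexp y := by
  unfold hexp
  rw [hsum_mul_hsum]
  simp only [expTerm_add h]

theorem hexp_mul_neg (x : A) : hexp x * hexp (-x) = 1 := by
  rw [← hexp_add (Commute.neg_right (Commute.refl x)), add_neg_cancel, hexp_zero]

theorem hexp_neg_mul (x : A) : hexp (-x) * hexp x = 1 := by
  rw [← hexp_add (Commute.neg_left (Commute.refl x)), neg_add_cancel, hexp_zero]

theorem isUnit_hexp (x : A) : IsUnit (hexp x) :=
  ⟨⟨hexp x, hexp (-x), hexp_mul_neg x, hexp_neg_mul x⟩, rfl⟩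

theorem hsinh_add {x y : A} (h : Commute x y) :
    hsinh (x + y) = hsinh x * hexp y + hexp (-x) * hsinh y := by
  unfold hsinh hexp
  rw [hsum_mul_hsum, hsum_mul_hsum, ← hsum_add]
  congr 1
  funext n
  have h' : Commute (-x) (-y) := (h.neg_left).neg_right
  have e1 : ∑ p ∈ Finset.HasAntidiagonal.antidiagonal n,
      (expTerm (p.1 + 1) x - expTerm (p.1 + 1) (-x)) * expTerm p.2 y =
      ∑ p ∈ Finset.HasAntidiagonal.antidiagonal (n + 1), (expTerm p.1 x - expTerm p.1 (-x)) * expTerm p.2 y := by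
    rw [Finset.Nat.antidiagonal_succ]
    simp [expTerm]
  have e2 : ∑ p ∈ Finset.HasAntidiagonal.antidiagonal n,
      expTerm p.1 (-x) * (expTerm (p.2 + 1) y - expTerm (p.2 + 1) (-y)) =
      ∑ p ∈ Finset.HasAntidiagonal.antidiagonal (n + 1), expTerm p.1 (-x) * (expTerm p.2 y - expTerm p.2 (-y)) := by
    rw [Finset.Nat.antidiagonal_succ']
    simp [expTerm]
  rw [e1, e2, neg_add, expTerm_add h, expTerm_add h', ← Finset.sum_sub_distrib,
    ← Finset.sum_add_distrib]
  refine Finset.sum_congr rfl fun p _ => ?_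
  noncomm_ring

theorem qnum_add {x y : A} (h : Commute x y) :
    qnum (x + y) = qnum x * hexp y + hexp (-x) * qnum y := by
  unfold qnum
  rw [hsinh_add h, smul_add, smul_mul_assoc, mul_smul_comm]

theorem hsinh_neg (x : A) : hsinh (-x) = -hsinh x := by
  unfold hsinh
  rw [← hsum_neg]
  simp only [neg_neg, neg_sub]

theorem qnum_neg (x : A) : qnum (-x) = -qnum x := by
  unfold qnum
  rw [hsinh_neg, smul_neg]

theorem map_hexp (f : A →ₐ[K] B) (x : A) : f (hexp x) = hexp (f x) := by
  unfold hexp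
  rw [← AlgHom.toLinearMap_apply, map_hsum]
  simp only [AlgHom.toLinearMap_apply, map_expTerm]

theorem map_qnum (f : A →ₐ[K] B) (x : A) : f (qnum x) = qnum (f x) := by
  unfold qnum hsinh
  rw [map_smul, ← AlgHom.toLinearMap_apply, map_hsum]
  simp only [AlgHom.toLinearMap_apply, map_sub, map_expTerm, map_neg]

/-- If `x e = e y` then `e^{ħx} e = e e^{ħy}`. -/
theorem hexp_semiconj {e x y : A} (h : SemiconjBy e y x) : SemiconjBy e (hexp y) (hexp x) := by
  unfold SemiconjBy hexp
  rw [← LinearMap.mulLeft_apply K, ← LinearMap.mulRight_apply K, map_hsum, map_hsum]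
  congr 1
  funext n
  simp only [LinearMap.mulLeft_apply, LinearMap.mulRight_apply, expTerm, mul_smul_comm,
    smul_mul_assoc, (h.pow_right n).eq]

end Series

/-! ### Opposite algebras, antipodes and `*`-structures

An algebra antihomomorphism `A → B` is a homomorphism `A → Bᵐᵒᵖ`, and a conjugate linear
antihomomorphism is a homomorphism `A → ConjOp B`. -/

/-- The opposite algebra with complex conjugate scalar multiplication. -/
structure ConjOp (A : Type*) where
  /-- The element of `A`, viewed in the conjugate opposite algebra. -/
  op ::
  /-- The underlying element of `A`. -/
  unop : A

section OppositeRing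

variable {A : Type*} [Ring A]

/-- Unwrapping, to the opposite ring. -/
def ConjOp.equiv : ConjOp A ≃ Aᵐᵒᵖ :=
  ⟨fun x => MulOpposite.op x.unop, fun x => ⟨x.unop⟩, fun _ => rfl, fun _ => rfl⟩

instance : Ring (ConjOp A) := (ConjOp.equiv (A := A)).ring

/-- Unwrapping, as an isomorphism of rings. -/
def ConjOp.ringEquiv : ConjOp A ≃+* Aᵐᵒᵖ := (ConjOp.equiv (A := A)).ringEquiv

theorem ConjOp.op_add (a b : A) : ConjOp.op (a + b) = ConjOp.op a + ConjOp.op b := rfl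
theorem ConjOp.op_sub (a b : A) : ConjOp.op (a - b) = ConjOp.op a - ConjOp.op b := rfl
theorem ConjOp.op_mul (a b : A) : ConjOp.op (a * b) = ConjOp.op b * ConjOp.op a := rfl
theorem ConjOp.op_one : ConjOp.op (1 : A) = 1 := rfl
theorem ConjOp.op_neg (a : A) : ConjOp.op (-a) = -ConjOp.op a := rfl

theorem ConjOp.op_pow (a : A) (n : ℕ) : ConjOp.op (a ^ n) = ConjOp.op a ^ n := by
  induction n with
  | zero => rfl
  | succ n ih => rw [pow_succ', pow_succ, ConjOp.op_mul, ih]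

end OppositeRing

section Opposite

variable {A B : Type*} [Ring A] [Algebra K A] [Ring B] [Algebra K B]

instance [IsAdicComplete hbarIdeal A] : IsAdicComplete hbarIdeal Aᵐᵒᵖ :=
  complete_of_addEquiv (MulOpposite.opAddEquiv (α := A)) fun _ => rfl

/-- Coefficientwise complex conjugation of `ℂ⟦ħ⟧`, so that `ħ` is real. -/
def conjK : K →+* K := PowerSeries.map (starRingEnd ℂ)

theorem conjK_hbar : conjK hbar = hbar := PowerSeries.map_X _

/-- The scalar `c` acts on the conjugate opposite algebra as its conjugate acts on `A`. -/
instance : Algebra K (ConjOp A) :=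
  RingHom.toAlgebra'
    (ConjOp.ringEquiv.symm.toRingHom.comp ((algebraMap K Aᵐᵒᵖ).comp conjK)) fun c x => by
      apply ConjOp.ringEquiv.injective
      simp only [RingHom.comp_apply, map_mul, RingEquiv.toRingHom_eq_coe, RingHom.coe_coe,
        RingEquiv.apply_symm_apply]
      exact Algebra.commutes _ _

theorem ConjOp.smul_op (c : K) (a : A) : c • ConjOp.op a = ConjOp.op (conjK c • a) := by
  rw [Algebra.smul_def, Algebra.smul_def, Algebra.commutes]
  rfl

/-- The identity of `A`, as an additive map. -/
def ConjOp.addEquiv : A ≃+ ConjOp A where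
  toFun := ConjOp.op
  invFun := ConjOp.unop
  left_inv := fun _ => rfl
  right_inv := fun _ => rfl
  map_add' := fun _ _ => rfl

theorem ConjOp.addEquiv_hbar (x : A) :
    ConjOp.addEquiv (hbar • x) = hbar • ConjOp.addEquiv x := by
  change ConjOp.op _ = hbar • ConjOp.op x
  rw [ConjOp.smul_op, conjK_hbar]

instance [IsAdicComplete hbarIdeal A] : IsAdicComplete hbarIdeal (ConjOp A) :=
  complete_of_addEquiv ConjOp.addEquiv ConjOp.addEquiv_hbar

/-- A homomorphism `f : A → B`, viewed between the conjugate opposite algebras. -/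
def ConjOp.map (f : A →ₐ[K] B) : ConjOp A →ₐ[K] ConjOp B where
  toFun := fun x => ConjOp.op (f x.unop)
  map_one' := congrArg ConjOp.op (map_one f)
  map_mul' := fun x y => congrArg ConjOp.op (map_mul f y.unop x.unop)
  map_zero' := congrArg ConjOp.op (map_zero f)
  map_add' := fun x y => congrArg ConjOp.op (map_add f x.unop y.unop)
  commutes' := fun c => congrArg ConjOp.op (f.commutes (conjK c))

theorem conjK_invFact (n : ℕ) : conjK (invFact n) = invFact n := by
  unfold conjK invFact
  ext
  simp [PowerSeries.coeff_C]

theorem conjK_hsinh_one : conjK (hsinh (1 : K)) = hsinh (1 : K) := by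
  unfold hsinh
  have h := addMap_hsum (conjK : K →+* K).toAddMonoidHom
    (fun x => by simp [smul_eq_mul, conjK_hbar])
    (fun n => expTerm (n + 1) (1 : K) - expTerm (n + 1) (-1 : K))
  simpa [expTerm, conjK_invFact] using h

theorem conjK_hsinh_one_inv : conjK (hsinh (1 : K))⁻¹ = (hsinh (1 : K))⁻¹ := by
  have h := congrArg conjK hsinh_mul_inv
  rw [map_mul, map_one, conjK_hsinh_one] at h
  calc conjK (hsinh (1 : K))⁻¹
      = (hsinh (1 : K) * (hsinh (1 : K))⁻¹) * conjK (hsinh (1 : K))⁻¹ := by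
        rw [hsinh_mul_inv, one_mul]
    _ = (hsinh (1 : K) * conjK (hsinh (1 : K))⁻¹) * (hsinh (1 : K))⁻¹ := by ring
    _ = (hsinh (1 : K))⁻¹ := by rw [h, one_mul]

theorem ConjOp.op_expTerm (n : ℕ) (a : A) : ConjOp.op (expTerm n a) = expTerm n (ConjOp.op a) := by
  unfold expTerm
  rw [← ConjOp.op_pow, ConjOp.smul_op, conjK_invFact]

theorem ConjOp.op_qnum [IsAdicComplete hbarIdeal A] (a : A) :
    ConjOp.op (qnum a) = qnum (ConjOp.op a) := by
  have h := addMap_hsum (ConjOp.addEquiv (A := A)).toAddMonoidHom ConjOp.addEquiv_hbar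
    (fun n => expTerm (n + 1) a - expTerm (n + 1) (-a))
  have h' : ConjOp.op (hsinh a) = hsinh (ConjOp.op a) := by
    refine h.trans ?_
    unfold hsinh
    congr 1
    funext n
    change ConjOp.op _ = _
    rw [ConjOp.op_sub, ConjOp.op_expTerm, ConjOp.op_expTerm, ConjOp.op_neg]
  unfold qnum
  rw [← h', ConjOp.smul_op, conjK_hsinh_one_inv]

theorem op_qnum [IsAdicComplete hbarIdeal A] (a : A) :
    MulOpposite.op (qnum a) = qnum (MulOpposite.op a) := by
  have h := map_hsum (MulOpposite.opLinearEquiv K (M := A)).toLinearMap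
    (fun n => expTerm (n + 1) a - expTerm (n + 1) (-a))
  unfold qnum hsinh
  rw [MulOpposite.op_smul]
  congr 1

/-- The antipode `S_A ⊗ S_B` of a tensor product. -/
def CT.antipode (SA : A →ₐ[K] Aᵐᵒᵖ) (SB : B →ₐ[K] Bᵐᵒᵖ) : CT A B →ₐ[K] (CT A B)ᵐᵒᵖ :=
  CT.lift ((AlgHom.op CT.inl).comp SA) ((AlgHom.op CT.inr).comp SB) fun a b => by
    rw [AlgHom.comp_apply, AlgHom.comp_apply]
    exact (CT.inl_commute_inr (SA a).unop (SB b).unop).op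

/-- The flipped `*`-structure `a ⊗ b ↦ b* ⊗ a*` on `A ⊗̂ A`. -/
def CT.flipStar (s : A →ₐ[K] ConjOp A) : CT A A →ₐ[K] ConjOp (CT A A) :=
  CT.lift ((ConjOp.map CT.inr).comp s) ((ConjOp.map CT.inl).comp s) fun a b => by
    rw [AlgHom.comp_apply, AlgHom.comp_apply]
    exact congrArg ConjOp.op (CT.inl_commute_inr (s b).unop (s a).unop).eq

end Opposite

/-! ## The quantum enveloping algebra of `su₂` -/

/-- The generators. -/
inductive Gen
  | E
  | H
  | F

/-- The `ħ`-adic algebra freely generated by `E`, `H`, `F`. -/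
abbrev FreeUh : Type := HC (FreeAlgebra K Gen)

/-- A generator, in the free `ħ`-adic algebra. -/
def gen (i : Gen) : FreeUh := HC.of (FreeAlgebra.ι K i)

/-- The defining relations `[H,E] = 2E`, `[H,F] = -2F` and
`[E,F] = (e^{ħH} - e^{-ħH}) / (e^ħ - e^{-ħ})`. -/
inductive UhRel : FreeUh → FreeUh → Prop
  | HE : UhRel (gen Gen.H * gen Gen.E - gen Gen.E * gen Gen.H) ((2 : K) • gen Gen.E)
  | HF : UhRel (gen Gen.H * gen Gen.F - gen Gen.F * gen Gen.H) ((-2 : K) • gen Gen.F)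
  | EF : UhRel (gen Gen.E * gen Gen.F - gen Gen.F * gen Gen.E) (qnum (gen Gen.H))

/-- The `ħ`-adic algebra `U_ħ(su₂)`: the `ħ`-adic algebra generated by `E`, `H`, `F` with the
defining relations. -/
abbrev Uh : Type := HC (RingQuot UhRel)

namespace Uh

/-- The quotient map from the free `ħ`-adic algebra. -/
def proj : FreeUh →ₐ[K] Uh := HC.of.comp (RingQuot.mkAlgHom K UhRel)

/-- The generator `E`. -/
def E : Uh := proj (gen Gen.E)
/-- The generator `H`. -/
def H : Uh := proj (gen Gen.H)
/-- The generator `F`. -/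
def F : Uh := proj (gen Gen.F)

theorem proj_rel {x y : FreeUh} (h : UhRel x y) : proj x = proj y := by
  rw [proj, AlgHom.comp_apply, AlgHom.comp_apply, RingQuot.mkAlgHom_rel K h]

theorem rel_HE : H * E - E * H = (2 : K) • E := by
  have h := proj_rel UhRel.HE
  rw [map_sub, map_mul, map_mul, map_smul] at h
  exact h

theorem rel_HF : H * F - F * H = (-2 : K) • F := by
  have h := proj_rel UhRel.HF
  rw [map_sub, map_mul, map_mul, map_smul] at h
  exact h

theorem rel_EF : E * F - F * E = qnum H := by
  have h := proj_rel UhRel.EF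
  rw [map_sub, map_mul, map_mul, map_qnum] at h
  exact h

section Lift

variable {B : Type*} [Ring B] [Algebra K B] [IsAdicComplete hbarIdeal B]

/-- The homomorphism from the free `ħ`-adic algebra with prescribed values on the generators. -/
def freeLift (e h f : B) : FreeUh →ₐ[K] B :=
  HC.lift (FreeAlgebra.lift K fun i => Gen.casesOn i e h f)

theorem freeLift_E (e h f : B) : freeLift e h f (gen Gen.E) = e := by
  rw [freeLift, gen, HC.lift_of, FreeAlgebra.lift_ι_apply]

theorem freeLift_H (e h f : B) : freeLift e h f (gen Gen.H) = h := by
  rw [freeLift, gen, HC.lift_of, FreeAlgebra.lift_ι_apply]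

theorem freeLift_F (e h f : B) : freeLift e h f (gen Gen.F) = f := by
  rw [freeLift, gen, HC.lift_of, FreeAlgebra.lift_ι_apply]

/-- Elements `e`, `h`, `f` of an `ħ`-adic algebra that satisfy the defining relations define a
homomorphism `E ↦ e`, `H ↦ h`, `F ↦ f` on `U_ħ(su₂)`. -/
def lift (e h f : B) (h1 : h * e - e * h = (2 : K) • e) (h2 : h * f - f * h = (-2 : K) • f)
    (h3 : e * f - f * e = qnum h) : Uh →ₐ[K] B :=
  HC.lift (RingQuot.liftAlgHom K ⟨freeLift e h f, fun x y hxy => by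
    cases hxy
    · simpa only [map_sub, map_mul, map_smul, freeLift_E, freeLift_H] using h1
    · simpa only [map_sub, map_mul, map_smul, freeLift_F, freeLift_H] using h2
    · simpa only [map_sub, map_mul, map_qnum, freeLift_E, freeLift_H, freeLift_F] using h3⟩)

variable (e h f : B) (h1 : h * e - e * h = (2 : K) • e) (h2 : h * f - f * h = (-2 : K) • f)
    (h3 : e * f - f * e = qnum h)

theorem lift_proj (x : FreeUh) : lift e h f h1 h2 h3 (proj x) = freeLift e h f x := by
  rw [lift, proj, AlgHom.comp_apply, HC.lift_of, RingQuot.liftAlgHom_mkAlgHom_apply]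

theorem lift_E : lift e h f h1 h2 h3 E = e := by rw [E, lift_proj, freeLift_E]

theorem lift_H : lift e h f h1 h2 h3 H = h := by rw [H, lift_proj, freeLift_H]

theorem lift_F : lift e h f h1 h2 h3 F = f := by rw [F, lift_proj, freeLift_F]

end Lift

/-! ### Commutation of the generators with exponentials -/

section Comm

variable {B : Type*} [Ring B] [Algebra K B] [IsAdicComplete hbarIdeal B]

/-- If `[h, e] = c e` with a scalar `c`, then `e^{ħh} e = e^{ħc} e e^{ħh}`. -/
theorem hexp_mul_of_rel {c : K} {e h : B} (he : h * e - e * h = c • e) :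
    hexp h * e = e * hexp h * hexp (algebraMap K B c) := by
  have hs : SemiconjBy e (h + algebraMap K B c) h := by
    unfold SemiconjBy
    rw [mul_add, ← Algebra.commutes, ← Algebra.smul_def, ← he]
    abel
  rw [← (hexp_semiconj hs).eq, hexp_add (Algebra.commutes c h).symm, mul_assoc]

end Comm

end Uh


namespace Uh

/-! ### The Hopf `*`-structure of `U_ħ(su₂)` -/

theorem rel_kF : hexp H * F = F * hexp H * hexp (algebraMap K Uh (-2)) :=
  hexp_mul_of_rel rel_HF

theorem rel_mE : hexp (-H) * E = E * hexp (-H) * hexp (algebraMap K Uh (-2)) := by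
  refine hexp_mul_of_rel ?_
  rw [neg_mul, mul_neg, neg_smul, ← rel_HE]
  abel

theorem commute_EF : Commute (E * F) H := by
  have h1 : H * E = E * H + (2 : K) • E := by rw [← rel_HE]; abel
  have h2 : H * F = F * H + (-2 : K) • F := by rw [← rel_HF]; abel
  refine Commute.symm ?_
  unfold Commute SemiconjBy
  rw [← mul_assoc, h1, add_mul, mul_assoc, h2, mul_add, smul_mul_assoc, mul_smul_comm, neg_smul,
    mul_assoc]
  abel

theorem commute_FE : Commute (F * E) H := by
  have h1 : H * E = E * H + (2 : K) • E := by rw [← rel_HE]; abel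
  have h2 : H * F = F * H + (-2 : K) • F := by rw [← rel_HF]; abel
  refine Commute.symm ?_
  unfold Commute SemiconjBy
  rw [← mul_assoc, h2, add_mul, mul_assoc, h1, mul_add, smul_mul_assoc, mul_smul_comm, neg_smul,
    mul_assoc]
  abel

theorem rel_mEFk : hexp (-H) * (E * F) * hexp H = E * F := by
  have h : Commute (E * F) (hexp H) := hexp_semiconj commute_EF
  rw [mul_assoc, h.eq, ← mul_assoc, hexp_neg_mul, one_mul]

theorem rel_kFEm : hexp H * (F * E) * hexp (-H) = F * E := by
  have h : Commute (F * E) (hexp H) := hexp_semiconj commute_FE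
  rw [← h.eq, mul_assoc, hexp_mul_neg, mul_one]

section Abstract

variable {B : Type*} [Ring B] [Algebra K B]

theorem comul_aux1 {c : K} {x1 h1 x2 h2 k2 : B} (r1 : h1 * x1 - x1 * h1 = c • x1)
    (r2 : h2 * x2 - x2 * h2 = c • x2) (c1 : k2 * h1 = h1 * k2) (c2 : h2 * x1 = x1 * h2)
    (c3 : k2 * h2 = h2 * k2) (c4 : h1 * x2 = x2 * h1) :
    (h1 + h2) * (x1 * k2 + x2) - (x1 * k2 + x2) * (h1 + h2) = c • (x1 * k2 + x2) := by
  rw [smul_add, ← smul_mul_assoc, ← r1, ← r2]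
  simp only [mul_add, add_mul, sub_mul, mul_assoc, c1, c3, c4]
  rw [← mul_assoc h2 x1 k2, c2, mul_assoc]
  abel

theorem comul_aux2 {c : K} {x1 h1 x2 h2 m1 : B} (r1 : h1 * x1 - x1 * h1 = c • x1)
    (r2 : h2 * x2 - x2 * h2 = c • x2) (c1 : m1 * h1 = h1 * m1) (c2 : h2 * m1 = m1 * h2)
    (c3 : h2 * x1 = x1 * h2) (c4 : h1 * x2 = x2 * h1) :
    (h1 + h2) * (x1 + m1 * x2) - (x1 + m1 * x2) * (h1 + h2) = c • (x1 + m1 * x2) := by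
  rw [smul_add, ← mul_smul_comm, ← r1, ← r2]
  simp only [mul_add, add_mul, mul_sub, mul_assoc, c3, ← c4]
  rw [← mul_assoc m1 h1 x2, c1, ← mul_assoc h2 m1 x2, c2, mul_assoc, mul_assoc]
  abel

end Abstract

theorem comul_aux3 {B : Type*} [Ring B] {e1 f1 m1 q1 e2 f2 k2 q2 z : B} (r1 : e1 * f1 - f1 * e1 = q1)
    (r2 : e2 * f2 - f2 * e2 = q2) (hm : m1 * e1 = e1 * m1 * z) (hk : k2 * f2 = f2 * k2 * z)
    (hz : ∀ x, x * z = z * x) (c1 : k2 * f1 = f1 * k2) (c2 : k2 * m1 = m1 * k2)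
    (c3 : e2 * f1 = f1 * e2) (c4 : e2 * m1 = m1 * e2) (c5 : f2 * e1 = e1 * f2) :
    (e1 * k2 + e2) * (f1 + m1 * f2) - (f1 + m1 * f2) * (e1 * k2 + e2) = q1 * k2 + m1 * q2 := by
  have h1 : e1 * k2 * (m1 * f2) = m1 * f2 * (e1 * k2) := by
    calc e1 * k2 * (m1 * f2) = e1 * (k2 * m1) * f2 := by noncomm_ring
      _ = e1 * m1 * (k2 * f2) := by rw [c2]; noncomm_ring
      _ = e1 * m1 * (f2 * k2 * z) := by rw [hk]
      _ = e1 * m1 * z * f2 * k2 := by rw [hz]; noncomm_ring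
      _ = m1 * (e1 * f2) * k2 := by rw [← hm]; noncomm_ring
      _ = m1 * f2 * (e1 * k2) := by rw [← c5]; noncomm_ring
  have h2 : e1 * k2 * f1 = e1 * f1 * k2 := by rw [mul_assoc, c1, mul_assoc]
  have h3 : e2 * (m1 * f2) = m1 * (e2 * f2) := by rw [← mul_assoc, c4, mul_assoc]
  rw [← r1, ← r2, add_mul, mul_add, mul_add, h1, h2, h3, c3]
  noncomm_ring

/-- The coproduct `Δ(E) = E ⊗ e^{ħH} + 1 ⊗ E`, `Δ(H) = H ⊗ 1 + 1 ⊗ H`,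
`Δ(F) = F ⊗ 1 + e^{-ħH} ⊗ F`. -/
def comul : Uh →ₐ[K] CT Uh Uh :=
  lift (CT.inl E * CT.inr (hexp H) + CT.inr E) (CT.inl H + CT.inr H)
    (CT.inl F + CT.inl (hexp (-H)) * CT.inr F)
    (comul_aux1 (by rw [← map_mul, ← map_mul, ← map_sub, rel_HE, map_smul])
      (by rw [← map_mul, ← map_mul, ← map_sub, rel_HE, map_smul])
      (CT.inl_commute_inr _ _).eq.symm (CT.inl_commute_inr _ _).eq.symm
      (by rw [← map_mul, ← map_mul]; exact congrArg _ (hexp_semiconj (Commute.refl H)).eq.symm)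
      (CT.inl_commute_inr _ _).eq)
    (comul_aux2 (by rw [← map_mul, ← map_mul, ← map_sub, rel_HF, map_smul])
      (by rw [← map_mul, ← map_mul, ← map_sub, rel_HF, map_smul])
      (by
        rw [← map_mul, ← map_mul]
        exact congrArg _ (hexp_semiconj (Commute.refl H).neg_right).eq.symm)
      (CT.inl_commute_inr _ _).eq.symm (CT.inl_commute_inr _ _).eq.symm
      (CT.inl_commute_inr _ _).eq)
    (by
      rw [qnum_add (CT.inl_commute_inr H H), ← map_neg, ← map_hexp, ← map_hexp, ← map_qnum,
        ← map_qnum]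
      refine comul_aux3 (z := algebraMap K (CT Uh Uh) (hexp (-2))) ?_ ?_ ?_ ?_ ?_
        (CT.inl_commute_inr _ _).eq.symm (CT.inl_commute_inr _ _).eq.symm
        (CT.inl_commute_inr _ _).eq.symm (CT.inl_commute_inr _ _).eq.symm
        (CT.inl_commute_inr _ _).eq.symm
      · rw [← map_mul, ← map_mul, ← map_sub, rel_EF]
      · rw [← map_mul, ← map_mul, ← map_sub, rel_EF]
      · rw [← map_mul, rel_mE, map_mul, map_mul, ← Algebra.ofId_apply, ← map_hexp, Algebra.ofId_apply,
          AlgHom.commutes]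
      · rw [← map_mul, rel_kF, map_mul, map_mul, ← Algebra.ofId_apply, ← map_hexp, Algebra.ofId_apply,
          AlgHom.commutes]
      · intro x
        exact (Algebra.commutes _ _).symm)

/-- The counit `ε(E) = ε(H) = ε(F) = 0`. -/
def counit : Uh →ₐ[K] K :=
  lift 0 0 0 (by simp) (by simp) (by
    have h := qnum_neg (0 : K)
    rw [neg_zero, eq_neg_iff_add_eq_zero, ← two_mul] at h
    have h2 : (2 : K) ≠ 0 := fun h2 => by
      have h3 := congrArg PowerSeries.constantCoeff h2
      rw [map_ofNat, map_zero] at h3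
      exact two_ne_zero h3
    simpa using ((mul_eq_zero.1 h).resolve_left h2).symm)

/-- The antipode `S(E) = -E e^{-ħH}`, `S(H) = -H`, `S(F) = -e^{ħH} F`. -/
def antipode : Uh →ₐ[K] Uhᵐᵒᵖ :=
  lift (MulOpposite.op (-(E * hexp (-H)))) (MulOpposite.op (-H))
    (MulOpposite.op (-(hexp H * F)))
    (by
      have hc : hexp (-H) * H = H * hexp (-H) :=
        (hexp_semiconj (Commute.refl H).neg_right).eq.symm
      rw [← MulOpposite.op_mul, ← MulOpposite.op_mul, ← MulOpposite.op_sub, ← MulOpposite.op_smul]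
      congr 1
      rw [smul_neg, ← smul_mul_assoc, ← rel_HE, neg_mul_neg, neg_mul_neg, mul_assoc, hc]
      noncomm_ring)
    (by
      have hc : hexp H * H = H * hexp H := (hexp_semiconj (Commute.refl H)).eq.symm
      rw [← MulOpposite.op_mul, ← MulOpposite.op_mul, ← MulOpposite.op_sub, ← MulOpposite.op_smul]
      congr 1
      rw [smul_neg, ← mul_smul_comm, ← rel_HF, neg_mul_neg, neg_mul_neg, ← mul_assoc H, ← hc]
      noncomm_ring)
    (by
      rw [← MulOpposite.op_mul, ← MulOpposite.op_mul, ← MulOpposite.op_sub, ← op_qnum, qnum_neg,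
        ← rel_EF]
      congr 1
      rw [neg_mul_neg, neg_mul_neg]
      have h1 : hexp H * F * (E * hexp (-H)) = F * E :=
        (by noncomm_ring : hexp H * F * (E * hexp (-H)) = hexp H * (F * E) * hexp (-H)).trans
          rel_kFEm
      have h2 : E * hexp (-H) * (hexp H * F) = E * F := by
        rw [mul_assoc, ← mul_assoc (hexp (-H)), hexp_neg_mul, one_mul]
      rw [h1, h2, neg_sub])

theorem conjK_two : conjK (2 : K) = 2 := map_ofNat conjK 2

/-- The `*`-structure `E* = F e^{ħH}`, `H* = H`, `F* = e^{-ħH} E`. -/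
def starHom : Uh →ₐ[K] ConjOp Uh :=
  lift (ConjOp.op (F * hexp H)) (ConjOp.op H) (ConjOp.op (hexp (-H) * E))
    (by
      have hc : hexp H * H = H * hexp H := (hexp_semiconj (Commute.refl H)).eq.symm
      rw [← ConjOp.op_mul, ← ConjOp.op_mul, ← ConjOp.op_sub, ConjOp.smul_op, conjK_two,
        ← smul_mul_assoc, ← neg_neg (2 : K), neg_smul, ← rel_HF, mul_assoc, hc]
      congr 1
      noncomm_ring)
    (by
      have hc : hexp (-H) * H = H * hexp (-H) :=
        (hexp_semiconj (Commute.refl H).neg_right).eq.symm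
      rw [← ConjOp.op_mul, ← ConjOp.op_mul, ← ConjOp.op_sub, ConjOp.smul_op, map_neg, conjK_two,
        neg_smul, ← mul_smul_comm, ← rel_HE, ← mul_assoc H, ← hc]
      congr 1
      noncomm_ring)
    (by
      rw [← ConjOp.op_mul, ← ConjOp.op_mul, ← ConjOp.op_sub, ← ConjOp.op_qnum, ← rel_EF]
      have h1 : hexp (-H) * E * (F * hexp H) = E * F :=
        (by noncomm_ring : hexp (-H) * E * (F * hexp H) = hexp (-H) * (E * F) * hexp H).trans
          rel_mEFk
      have h2 : F * hexp H * (hexp (-H) * E) = F * E := by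
        rw [mul_assoc, ← mul_assoc (hexp H), hexp_mul_neg, one_mul]
      rw [h1, h2])

/-! ### The universal R-matrix -/

/-- The quantum factorial `[n]! = [1] [2] ⋯ [n]`. -/
def qfact (n : ℕ) : K := ∏ k ∈ Finset.range n, qnum ((k + 1 : ℕ) : K)

/-- `ħⁿ Rcoef n = e^{ħn(n-1)/2} (e^ħ - e^{-ħ})ⁿ / [n]!`. -/
def Rcoef (n : ℕ) : K := hexp ((n.choose 2 : ℕ) : K) * hsinh (1 : K) ^ n * (qfact n)⁻¹

theorem constantCoeff_qnum_natCast (n : ℕ) : PowerSeries.constantCoeff (qnum (n : K)) = n := by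
  have h : PowerSeries.constantCoeff (hsinh (n : K)) = 2 * n := by
    unfold hsinh
    rw [hsum_succ]
    simp [expTerm, invFact]
    ring
  rw [qnum, smul_eq_mul, map_mul, h, PowerSeries.constantCoeff_inv, constantCoeff_hsinh_one]
  field_simp

theorem qfact_mul_inv (n : ℕ) : qfact n * (qfact n)⁻¹ = 1 := by
  refine PowerSeries.mul_inv_cancel _ ?_
  unfold qfact
  rw [map_prod, Finset.prod_ne_zero_iff]
  intro k _
  rw [constantCoeff_qnum_natCast]
  exact_mod_cast k.succ_ne_zero

theorem hbar_pow_mul_Rcoef (n : ℕ) : hbar ^ n * Rcoef n * qfact n =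
    hexp ((n.choose 2 : ℕ) : K) * (hexp (1 : K) - hexp (-1 : K)) ^ n := by
  have h : hexp (1 : K) - hexp (-1 : K) = hbar * hsinh (1 : K) := (hbar_smul_hsinh (1 : K)).symm
  rw [h, mul_pow, Rcoef]
  linear_combination
    (hbar ^ n * hexp ((n.choose 2 : ℕ) : K) * hsinh (1 : K) ^ n) * qfact_mul_inv n

/-- The universal R-matrix `e^{ħ(H ⊗ H)/2} ∑ₙ e^{ħn(n-1)/2} (e^ħ - e^{-ħ})ⁿ / [n]! (Eⁿ ⊗ Fⁿ)`. -/
def R : CT Uh Uh :=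
  hexp (algebraMap ℂ K (1 / 2) • (CT.inl H * CT.inr H)) *
    hsum fun n => Rcoef n • (CT.inl E ^ n * CT.inr F ^ n)

theorem hexp_K_zero : hexp (0 : K) = 1 := hexp_zero

theorem isUnit_R : IsUnit R := by
  refine (isUnit_hexp _).mul (isUnit_hsum ?_)
  simp [Rcoef, qfact, hexp_K_zero]

/-- The universal R-matrix as an invertible element. -/
def RUnit : (CT Uh Uh)ˣ := isUnit_R.unit

theorem coe_RUnit : (RUnit : CT Uh Uh) = R := rfl

end Uh

/-! ## Twists -/

/-- The homomorphism `g ↦ u f(g) u⁻¹`. -/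
def conjHom {A B : Type*} [Ring A] [Algebra K A] [Ring B] [Algebra K B] (u : Bˣ)
    (f : A →ₐ[K] B) : A →ₐ[K] B where
  toFun := fun g => u * f g * ↑u⁻¹
  map_one' := by rw [map_one, mul_one, Units.mul_inv]
  map_mul' := fun a b => by
    rw [map_mul, mul_assoc (u * f a), mul_assoc (u : B) (f b), Units.inv_mul_cancel_left]
    simp only [mul_assoc]
  map_zero' := by rw [map_zero, mul_zero, zero_mul]
  map_add' := fun a b => by rw [map_add, mul_add, add_mul]
  commutes' := fun c => by
    rw [AlgHom.commutes, ← Algebra.commutes, mul_assoc, Units.mul_inv, mul_one]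

section Twist

variable {A B : Type*} [Ring A] [Algebra K A] [IsAdicComplete hbarIdeal A] [Ring B] [Algebra K B]

/-- `ε ⊗ id : A ⊗̂ A → A`. -/
def counitLeft (ε : A →ₐ[K] K) : CT A A →ₐ[K] A :=
  CT.lift ((Algebra.ofId K A).comp ε) (AlgHom.id K A) fun a b => by
    rw [AlgHom.comp_apply, Algebra.ofId_apply]
    exact Algebra.commutes _ _

/-- `id ⊗ ε : A ⊗̂ A → A`. -/
def counitRight (ε : A →ₐ[K] K) : CT A A →ₐ[K] A :=
  CT.lift (AlgHom.id K A) ((Algebra.ofId K A).comp ε) fun a b => by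
    rw [AlgHom.comp_apply, Algebra.ofId_apply]
    exact (Algebra.commutes _ _).symm

/-- The (counital) Drinfeld twists from the coproduct `Δ` with counit `ε` to the coproduct `Δ'`
on the same algebra. -/
structure IsTwist (Δ : A →ₐ[K] CT A A) (ε : A →ₐ[K] K) (Δ' : A →ₐ[K] CT A A)
    (F : (CT A A)ˣ) : Prop where
  counit_left : counitLeft ε F = 1
  counit_right : counitRight ε F = 1
  comul_eq : ∀ g, Δ' g = F * Δ g * ↑F⁻¹

/-- The coproduct `(α ⊗ α) ∘ Δ ∘ α⁻¹` transferred along an isomorphism of algebras. -/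
def transfer (α : B ≃ₐ[K] A) (Δ : B →ₐ[K] CT B B) : A →ₐ[K] CT A A :=
  ((CT.map α.toAlgHom α.toAlgHom).comp Δ).comp α.symm.toAlgHom

/-- The image of an invertible element of `B ⊗̂ B` under `α ⊗ α`. -/
def transferUnit (α : B ≃ₐ[K] A) (T : (CT B B)ˣ) : (CT A A)ˣ :=
  Units.map (CT.map α.toAlgHom α.toAlgHom : CT B B →ₐ[K] CT A A) T

end Twist

section Legs

variable {A B : Type*} [Ring A] [Algebra K A] [Ring B] [Algebra K B]

/-- `F₁₃ ∈ (A ⊗̂ B) ⊗̂ (A ⊗̂ B)` for an invertible `F ∈ A ⊗̂ A`. -/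
def F13 (F : (CT A A)ˣ) : (CT (CT A B) (CT A B))ˣ :=
  Units.map (CT.leg13 : CT A A →ₐ[K] CT (CT A B) (CT A B)) F

/-- `F₂₄ ∈ (A ⊗̂ B) ⊗̂ (A ⊗̂ B)` for an invertible `F ∈ B ⊗̂ B`. -/
def F24 (F : (CT B B)ˣ) : (CT (CT A B) (CT A B))ˣ :=
  Units.map (CT.leg24 : CT B B →ₐ[K] CT (CT A B) (CT A B)) F

end Legs

/-! ## The undeformed enveloping algebra `U(su₂)[[ħ]]` -/

/-- The complexification `A₁ = sl₂` of `su₂`. -/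
abbrev A1 : Type := LieAlgebra.SpecialLinear.sl (Fin 2) ℂ

/-- The `ħ`-adic completion `U(su₂)[[ħ]]` of the enveloping algebra. -/
abbrev U0 : Type := HC (K ⊗[ℂ] UniversalEnvelopingAlgebra ℂ A1)

namespace U0

section LieStructure

/- The commutator bracket of an associative algebra. -/
attribute [local instance] LieRing.ofAssociativeRing

/-- The inclusion of the enveloping algebra. -/
def incl : UniversalEnvelopingAlgebra ℂ A1 →ₐ[ℂ] U0 :=
  ((HC.of (A := K ⊗[ℂ] UniversalEnvelopingAlgebra ℂ A1)).restrictScalars ℂ).comp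
    Algebra.TensorProduct.includeRight

/-- The primitive coproduct `x ↦ x ⊗ 1 + 1 ⊗ x` on the Lie algebra. -/
def primitive : A1 →ₗ⁅ℂ⁆ CT U0 U0 where
  toFun := fun x => CT.inl (incl (UniversalEnvelopingAlgebra.ι ℂ x)) +
    CT.inr (incl (UniversalEnvelopingAlgebra.ι ℂ x))
  map_add' := fun x y => by
    simp only [map_add]
    abel
  map_smul' := fun c x => by
    simp only [map_smul, smul_add, RingHom.id_apply]
    congr 1
    · exact map_smul ((CT.inl : U0 →ₐ[K] CT U0 U0).restrictScalars ℂ) c _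
    · exact map_smul ((CT.inr : U0 →ₐ[K] CT U0 U0).restrictScalars ℂ) c _
  map_lie' := fun {x y} => by
    simp only [LieHom.map_lie, LieRing.of_associative_ring_bracket, map_sub, map_mul, mul_add,
      add_mul, (CT.inl_commute_inr _ _).eq]
    abel

/-- The coproduct of `U(su₂)[[ħ]]`, with `Δ(x) = x ⊗ 1 + 1 ⊗ x` on the Lie algebra. -/
def comul : U0 →ₐ[K] CT U0 U0 :=
  HC.lift (Algebra.TensorProduct.lift (Algebra.ofId K (CT U0 U0))
    (UniversalEnvelopingAlgebra.lift ℂ primitive) fun c _ => Algebra.commutes c _)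

/-- The counit of `U(su₂)[[ħ]]`, which vanishes on the Lie algebra. -/
def counit : U0 →ₐ[K] K :=
  HC.lift (Algebra.TensorProduct.lift (Algebra.ofId K K)
    (UniversalEnvelopingAlgebra.lift ℂ (0 : A1 →ₗ⁅ℂ⁆ K)) fun _ _ => Commute.all _ _)

end LieStructure

end U0

/-! ## The quantum Euclidean and the quantum Lorentz algebra -/

/-- The algebra `U_ħ(su₂) ⊗̂ U_ħ(su₂)` underlying both `U_ħ(so₄)` and `U_ħ(sl₂(ℂ))`. -/
abbrev So4 : Type := CT Uh Uh

namespace So4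

/-- The coproduct of `U_ħ(so₄)`. -/
def comul : So4 →ₐ[K] CT So4 So4 := CT.comul Uh.comul Uh.comul

/-- The counit of `U_ħ(so₄)`, and of `U_ħ(sl₂(ℂ))`. -/
def counit : So4 →ₐ[K] K := CT.counit Uh.counit Uh.counit

/-- The antipode of `U_ħ(so₄)`. -/
def antipode (g : So4) : So4 := (CT.antipode Uh.antipode Uh.antipode g).unop

/-- The flipped `*`-structure `a ⊗ b ↦ b* ⊗ a*` on `U_ħ(so₄)`. -/
def flipStar (g : So4) : So4 := (CT.flipStar Uh.starHom g).unop

/-- `R₂₃ = 1 ⊗ R ⊗ 1`. -/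
def R23 : (CT So4 So4)ˣ := Units.map (CT.leg23 : CT Uh Uh →ₐ[K] CT So4 So4) Uh.RUnit

/-- `R₂₁`, the flip of `R`. -/
def R21 : So4ˣ := Units.map (CT.flip : CT Uh Uh →ₐ[K] CT Uh Uh) Uh.RUnit

end So4

namespace Lorentz

/-- The coproduct `g ↦ R₂₃⁻¹ Δ(g) R₂₃` of `U_ħ(sl₂(ℂ))`. -/
def comul : So4 →ₐ[K] CT So4 So4 := conjHom So4.R23⁻¹ So4.comul

/-- The antipode `g ↦ R₂₁ S(g) R₂₁⁻¹` of `U_ħ(sl₂(ℂ))`. -/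
def antipode (g : So4) : So4 := So4.R21 * So4.antipode g * ↑So4.R21⁻¹

/-- The `*`-structure `a ⊗ b ↦ R₂₁ (b* ⊗ a*) R₂₁⁻¹` of `U_ħ(sl₂(ℂ))`. -/
def star (g : So4) : So4 := So4.R21 * So4.flipStar g * ↑So4.R21⁻¹

end Lorentz

/-! ## Module algebras -/

section ModuleAlgebra

variable {A : Type*} [Ring A] [Algebra K A]
  {X : Type*} [AddCommGroup X] [Module K X] [Module A X] [IsScalarTower K A X]

/-- The linear map `a ↦ a ▷ x`. -/
def orbitMap (x : X) : A →ₗ[K] X := (LinearMap.toSpanSingleton A X x).restrictScalars K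

theorem orbitMap_apply (x : X) (a : A) : orbitMap x a = a • x := rfl

variable [IsAdicComplete hbarIdeal X]

/-- `T ↦ μ(T ▷ (x ⊗ y))` for `T ∈ A ⊗̂ A`: the continuous extension of
`a ⊗ b ↦ μ((a ▷ x) ⊗ (b ▷ y))`. -/
def mulAct (μ : X →ₗ[K] X →ₗ[K] X) (x y : X) : CT A A →ₗ[K] X :=
  CT.extend (TensorProduct.lift (μ.compl₁₂ (orbitMap x) (orbitMap y)))

theorem mulAct_of (μ : X →ₗ[K] X →ₗ[K] X) (x y : X) (a b : A) :
    mulAct μ x y (CT.of (a ⊗ₜ b)) = μ (a • x) (b • y) := by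
  rw [mulAct, CT.extend_of, TensorProduct.lift.tmul, LinearMap.compl₁₂_apply, orbitMap_apply,
    orbitMap_apply]

/-- The twisted multiplication `x ⊗ y ↦ μ(T ▷ (x ⊗ y))`. -/
def twistedMul (μ : X →ₗ[K] X →ₗ[K] X) (T : CT A A) : X →ₗ[K] X →ₗ[K] X :=
  LinearMap.mk₂ K (fun x y => mulAct μ x y T)
    (fun x x' y => by
      have h : mulAct (A := A) μ (x + x') y = mulAct μ x y + mulAct μ x' y :=
        CT.hom_ext fun a b => by
          simp only [LinearMap.add_apply, mulAct_of, smul_add, map_add]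
      rw [h, LinearMap.add_apply])
    (fun c x y => by
      have h : mulAct (A := A) μ (c • x) y = c • mulAct μ x y :=
        CT.hom_ext fun a b => by
          simp only [LinearMap.smul_apply, mulAct_of, smul_algebra_smul_comm, map_smul]
      rw [h, LinearMap.smul_apply])
    (fun x y y' => by
      have h : mulAct (A := A) μ x (y + y') = mulAct μ x y + mulAct μ x y' :=
        CT.hom_ext fun a b => by
          simp only [LinearMap.add_apply, mulAct_of, smul_add, map_add]
      rw [h, LinearMap.add_apply])
    (fun c x y => by
      have h : mulAct (A := A) μ x (c • y) = c • mulAct μ x y :=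
        CT.hom_ext fun a b => by
          simp only [LinearMap.smul_apply, mulAct_of, smul_algebra_smul_comm, map_smul]
      rw [h, LinearMap.smul_apply])

theorem twistedMul_apply (μ : X →ₗ[K] X →ₗ[K] X) (T : CT A A) (x y : X) :
    twistedMul μ T x y = mulAct μ x y T := rfl

/-- `(X, μ)` is a module algebra with respect to the coproduct `Δ`: the multiplication `μ` is
associative and `g ▷ μ(x ⊗ y) = μ(Δ(g) ▷ (x ⊗ y))`. -/
structure IsModuleAlgebra (Δ : A →ₐ[K] CT A A) (μ : X →ₗ[K] X →ₗ[K] X) : Prop where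
  assoc : ∀ x y z, μ (μ x y) z = μ x (μ y z)
  covariant : ∀ (g : A) (x y : X), g • μ x y = mulAct μ x y (Δ g)

/-- `(X, μ, *)` is a module `*`-algebra with respect to the coproduct `Δ`, the antipode `S` and
the `*`-structure `st` of the Hopf algebra: a module algebra with a `*`-structure such that
`(g ▷ x)* = (S g)* ▷ x*`. -/
structure IsModuleStarAlgebra (Δ : A →ₐ[K] CT A A) (S st : A → A) (μ : X →ₗ[K] X →ₗ[K] X)
    (s : X → X) : Prop extends IsModuleAlgebra Δ μ where
  star_add : ∀ x y, s (x + y) = s x + s y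
  star_smul : ∀ (c : K) (x : X), s (c • x) = conjK c • s x
  star_mul : ∀ x y, s (μ x y) = μ (s y) (s x)
  star_star : ∀ x, s (s x) = x
  star_act : ∀ (g : A) (x : X), s (g • x) = st (S g) • s x

end ModuleAlgebra

section ModuleUnit

variable {A : Type*} [Ring A] [Algebra K A] {X : Type*} [AddCommGroup X] [Module K X] [Module A X]

/-- `one` is a unit element for `μ`, with `g ▷ one = ε(g) one`. -/
structure IsModuleUnit (ε : A →ₐ[K] K) (μ : X →ₗ[K] X →ₗ[K] X) (one : X) : Prop where
  one_mul : ∀ x, μ one x = x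
  mul_one : ∀ x, μ x one = x
  act_one : ∀ g : A, g • one = ε g • one

end ModuleUnit

end QLorentz

end

noncomputable section

open scoped TensorProduct

namespace QLorentz

/-! ## The quantum binomial formula -/

section QuantumBinomial

/-! The statement rests on the hexagon identities (Δ ⊗ id)(R) = R₁₃R₂₃ and (id ⊗ Δ)(R) = R₁₃R₁₂.
They make `R₂₃` a counital 2-cocycle for the tensor product coproduct: in three copies of `So4`,
with six tensor factors, the cocycle identity reads R₂₅R₄₅·R₂₃ = R₂₅R₂₃·R₄₅, and R₄₅ commutes with
R₂₃ because their legs are disjoint (`So4.R23_cocycle`).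

The hexagons (`Rof_hexagon_left`, `Rof_hexagon_right`) are the exponential law for q-exponentials.
The two summands of Δ(E), and those of Δ(F), q-commute with ratio e^{-2ħ}, and the coefficients of R
are those of the matching q-exponential (`Rcoef_binomial`). Moving a Cartan factor e^{ħ(H⊗H)/2} past
a nilpotent factor produces exactly the e^{±ħH} that occurs in the coproduct.

Module algebras: for a cocycle J, the product μ(J ▷ [x ⊗ y]) is covariant under J⁻¹ΔJ, and its
associativity is the cocycle identity applied to a threefold product (`IsModuleAlgebra.twist`). The
unit survives because both counit contractions of J are 1.

Stars: put σ(a) = (Sa)*. The involution turns the action of T on x ⊗ y into the action of the image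
of T under a ⊗ b ↦ σ(b) ⊗ σ(a) on y* ⊗ x*, and that map fixes R₂₃ (`So4.starAntipode₂_R23`). The
conjugations by R₂₁ in the Lorentz antipode and star cancel in the composite, because R₂₁ is
self-adjoint for the flipped star (`So4.flipStar_R21`).

Drinfeld twists: legs 13 and 24 commute, so two twists multiply to a twist for the tensor product
(`IsTwist.tensor`); a further factor R₂₃⁻¹ conjugates the target coproduct (`IsTwist.mul`). Since α'
and α'' need not respect counits, the normalisation of R₂₃ is needed for every character; it holds
because every character of `Uh` kills E, H and F. -/

open Finset in
/-- The exponential law of `q`-exponentials, for `q`-commuting variables. -/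
theorem qbinomial {B : Type*} [Ring B] [Algebra K B] {p l : K} {d s : ℕ → K} {X Y : B}
    (hXY : Y * X = p • (X * Y)) (d0 : d 0 = 1) (s0 : s 0 = 0)
    (hs : ∀ a b, s (a + b) = s a + p ^ a * s b) (hd : ∀ n, s (n + 1) * d (n + 1) = l * d n)
    (hu : ∀ n, IsUnit (s (n + 1))) (n : ℕ) :
    ∑ i ∈ antidiagonal n, (d i.1 * d i.2) • (X ^ i.1 * Y ^ i.2) = d n • (X + Y) ^ n := by
  have hYX (a : ℕ) : Y * X ^ a = p ^ a • (X ^ a * Y) := by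
    induction a with
    | zero => simp
    | succ a ih =>
      rw [pow_succ, ← mul_assoc, ih, smul_mul_assoc, mul_assoc, hXY, mul_smul_comm, smul_smul,
        pow_succ, ← mul_assoc]
  induction n with
  | zero => simp [d0]
  | succ n ih =>
    -- Multiplication by s(n+1) = s(i) + pⁱ s(j) splits the sum in two. The recursion for d lowers
    -- one index in each part, and the parts become X and Y times the identity in degree n; the unit
    -- s(n+1) is cancelled at the end.
    have h1 : (s (n + 1)) • ∑ i ∈ antidiagonal (n + 1), (d i.1 * d i.2) • (X ^ i.1 * Y ^ i.2) =
        ∑ i ∈ antidiagonal (n + 1), (s i.1 * d i.1 * d i.2) • (X ^ i.1 * Y ^ i.2) +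
        ∑ i ∈ antidiagonal (n + 1), (p ^ i.1 * d i.1 * (s i.2 * d i.2)) • (X ^ i.1 * Y ^ i.2) := by
      rw [smul_sum, ← sum_add_distrib]
      refine sum_congr rfl fun i hi => ?_
      rw [← mem_antidiagonal.1 hi, hs, smul_smul, ← add_smul]
      congr 1
      ring
    have h2 : l • ((X + Y) * ∑ i ∈ antidiagonal n, (d i.1 * d i.2) • (X ^ i.1 * Y ^ i.2)) =
        ∑ i ∈ antidiagonal n, (l * d i.1 * d i.2) • (X ^ (i.1 + 1) * Y ^ i.2) +
        ∑ i ∈ antidiagonal n, (p ^ i.1 * d i.1 * (l * d i.2)) • (X ^ i.1 * Y ^ (i.2 + 1)) := by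
      rw [mul_sum, smul_sum, ← sum_add_distrib]
      refine sum_congr rfl fun i _ => ?_
      rw [mul_smul_comm, add_mul, ← mul_assoc, ← mul_assoc Y, hYX, smul_mul_assoc, mul_assoc _ Y,
        ← pow_succ', ← pow_succ', smul_add, smul_add, smul_smul, smul_smul, smul_smul]
      congr 2 <;> ring
    have h3 : ∑ i ∈ antidiagonal (n + 1), (s i.1 * d i.1 * d i.2) • (X ^ i.1 * Y ^ i.2) =
        ∑ i ∈ antidiagonal n, (l * d i.1 * d i.2) • (X ^ (i.1 + 1) * Y ^ i.2) := by
      rw [Nat.sum_antidiagonal_succ]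
      simp only [s0, zero_mul, zero_smul, zero_add, hd]
    have h4 : ∑ i ∈ antidiagonal (n + 1),
          (p ^ i.1 * d i.1 * (s i.2 * d i.2)) • (X ^ i.1 * Y ^ i.2) =
        ∑ i ∈ antidiagonal n, (p ^ i.1 * d i.1 * (l * d i.2)) • (X ^ i.1 * Y ^ (i.2 + 1)) := by
      rw [Nat.sum_antidiagonal_succ']
      simp only [s0, zero_mul, mul_zero, zero_smul, zero_add, hd]
    rw [h3, h4] at h1
    rw [← h2, ih, mul_smul_comm, ← pow_succ', smul_smul, ← hd, ← smul_smul] at h1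
    exact (hu n).smul_left_cancel.1 h1

/-- The `p`-integers `1 + p + ⋯ + pⁿ⁻¹` for `p = e^{-2ħ}`. -/
def geom (n : ℕ) : K := ∑ i ∈ Finset.range n, hexp (-2 : K) ^ i

theorem geom_add (a b : ℕ) : geom (a + b) = geom a + hexp (-2 : K) ^ a * geom b := by
  unfold geom
  rw [Finset.sum_range_add, Finset.mul_sum]
  simp only [pow_add]

theorem qnum_one : qnum (1 : K) = 1 := by
  rw [qnum, smul_eq_mul, mul_comm, hsinh_mul_inv]

/-- Compares symmetric quantum integers with p-integers for p = e^{-2ħ}. Over a whole factorial the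
ratio accumulates to e^{ħn(n-1)/2}, which is the prefactor in the R-matrix. -/
theorem hexp_mul_geom (n : ℕ) : hexp (n : K) * geom (n + 1) = qnum ((n + 1 : ℕ) : K) := by
  induction n with
  | zero => simp [geom, qnum_one, Uh.hexp_K_zero]
  | succ n ih =>
    have h1 : qnum ((n + 1 + 1 : ℕ) : K) =
        hexp ((n + 1 : ℕ) : K) + hexp (-1 : K) * qnum ((n + 1 : ℕ) : K) := by
      rw [Nat.cast_add, Nat.cast_one, add_comm _ (1 : K), qnum_add (Commute.all _ _), qnum_one,
        one_mul]
    have h2 : hexp ((n + 1 : ℕ) : K) * hexp (-2 : K) = hexp (-1 : K) * hexp (n : K) := by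
      rw [← hexp_add (Commute.all _ _), ← hexp_add (Commute.all _ _)]
      congr 1
      push_cast
      ring
    have h3 : geom (n + 1 + 1) = 1 + hexp (-2 : K) * geom (n + 1) := by
      rw [add_comm (n + 1) 1, geom_add]
      simp [geom]
    rw [h1, h3, ← ih]
    linear_combination geom (n + 1) * h2

theorem isUnit_geom (n : ℕ) : IsUnit (geom (n + 1)) := by
  have h : IsUnit (qnum ((n + 1 : ℕ) : K)) := by
    rw [PowerSeries.isUnit_iff_constantCoeff, Uh.constantCoeff_qnum_natCast, isUnit_iff_ne_zero]
    exact_mod_cast n.succ_ne_zero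
  rw [← hexp_mul_geom] at h
  exact isUnit_of_mul_isUnit_right h

theorem Rcoef_zero : Uh.Rcoef 0 = 1 := by
  simp [Uh.Rcoef, Uh.qfact, Uh.hexp_K_zero]

/-- The recursion that characterises the coefficients of a p-exponential: the prefactor
e^{ħn(n-1)/2} turns 1/[n]! into the inverse of a p-factorial, leaving only a power of `hsinh 1`. -/
theorem geom_mul_Rcoef (n : ℕ) :
    geom (n + 1) * Uh.Rcoef (n + 1) = hsinh (1 : K) * Uh.Rcoef n := by
  have h1 : hexp (((n + 1).choose 2 : ℕ) : K) = hexp (n : K) * hexp ((n.choose 2 : ℕ) : K) := by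
    rw [Nat.choose_succ_succ' n 1, Nat.choose_one_right, Nat.cast_add, hexp_add (Commute.all _ _)]
  have h2 : Uh.qfact (n + 1) = Uh.qfact n * qnum ((n + 1 : ℕ) : K) := Finset.prod_range_succ _ _
  have h3 := Uh.qfact_mul_inv (n + 1)
  have h4 := Uh.qfact_mul_inv n
  have h5 : qnum ((n + 1 : ℕ) : K) * (Uh.qfact (n + 1))⁻¹ = (Uh.qfact n)⁻¹ := by
    rw [h2] at h3 ⊢
    linear_combination (Uh.qfact n)⁻¹ * h3 - qnum ((n + 1 : ℕ) : K) *
      (Uh.qfact n * qnum ((n + 1 : ℕ) : K))⁻¹ * h4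
  unfold Uh.Rcoef
  rw [h1, ← h5, ← hexp_mul_geom]
  ring

theorem Rcoef_binomial {B : Type*} [Ring B] [Algebra K B] {X Y : B}
    (hXY : Y * X = hexp (-2 : K) • (X * Y)) (n : ℕ) :
    ∑ i ∈ Finset.HasAntidiagonal.antidiagonal n,
      (Uh.Rcoef i.1 * Uh.Rcoef i.2) • (X ^ i.1 * Y ^ i.2) = Uh.Rcoef n • (X + Y) ^ n :=
  qbinomial hXY Rcoef_zero (by simp [geom]) geom_add geom_mul_Rcoef isUnit_geom n

end QuantumBinomial

/-! ## R-matrices in `ħ`-adic algebras -/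

section RMatrix

variable {B C : Type*} [Ring B] [Algebra K B] [IsAdicComplete hbarIdeal B]
  [Ring C] [Algebra K C] [IsAdicComplete hbarIdeal C]

theorem semiconjBy_hsum {u : B} {a b : ℕ → B} (h : ∀ n, SemiconjBy u (a n) (b n)) :
    SemiconjBy u (hsum a) (hsum b) := by
  unfold SemiconjBy
  rw [← LinearMap.mulLeft_apply K, ← LinearMap.mulRight_apply K, map_hsum, map_hsum]
  congr 1
  funext n
  exact h n

theorem commute_hexp {x y : B} (h : Commute x y) : Commute x (hexp y) := hexp_semiconj h

/-- The scalar `1 / 2`. -/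
def half : K := algebraMap ℂ K (1 / 2)

theorem half_mul_two : half * 2 = 1 := by
  rw [half, ← map_ofNat (algebraMap ℂ K) 2, ← map_mul]
  norm_num

/-- The Cartan part `e^{ħ h h' / 2}` of the R-matrix. -/
def cartanOf (h h' : B) : B := hexp (half • (h * h'))

/-- The sum `∑ₙ e^{ħn(n-1)/2} (e^ħ - e^{-ħ})ⁿ / [n]! eⁿ fⁿ`. -/
def nilOf (e f : B) : B := hsum fun n => Uh.Rcoef n • (e ^ n * f ^ n)

/-- The element of an `ħ`-adic algebra that is obtained from the universal R-matrix by substituting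
`e`, `h` for `E`, `H` in the first and `f`, `h'` for `F`, `H` in the second factor. -/
def Rof (e h f h' : B) : B := cartanOf h h' * nilOf e f

theorem R_eq_Rof :
    Uh.R = Rof (CT.inl Uh.E) (CT.inl Uh.H) (CT.inr Uh.F) (CT.inr Uh.H : CT Uh Uh) := rfl

/-- Algebra homomorphisms commute with ħ-adic sums. Every image of R under maps of legs is thus
again of the form `Rof`, and identities between such images reduce to elements with prescribed
commutation relations. -/
theorem map_Rof (φ : B →ₐ[K] C) (e h f h' : B) :
    φ (Rof e h f h') = Rof (φ e) (φ h) (φ f) (φ h') := by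
  unfold Rof cartanOf nilOf
  rw [map_mul, map_hexp, map_smul, map_mul]
  congr 1
  rw [← AlgHom.toLinearMap_apply, map_hsum]
  simp only [AlgHom.toLinearMap_apply, map_smul, map_mul, map_pow]

theorem commute_Rof {x e h f h' : B} (h1 : Commute x e) (h2 : Commute x h) (h3 : Commute x f)
    (h4 : Commute x h') : Commute x (Rof e h f h') :=
  (commute_hexp ((h2.mul_right h4).smul_right _)).mul_right
    (semiconjBy_hsum fun n => ((h1.pow_right n).mul_right (h3.pow_right n)).smul_right _)

theorem commute_cartanOf {x h h' : B} (h1 : Commute x h) (h2 : Commute x h') :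
    Commute x (cartanOf h h') := commute_hexp ((h1.mul_right h2).smul_right _)

/-- Passing f through ah/2 shifts h by 2, hence ah/2 by a; after exponentiation this is the factor
e^{ħa}. -/
theorem cartanOf_mul_right {a h f : B} (r : h * f - f * h = (-2 : K) • f) (ca : Commute a h)
    (cf : Commute a f) : cartanOf a h * (hexp a * f) = f * cartanOf a h := by
  have hs : SemiconjBy f (half • (a * h)) (half • (a * h) + a) := by
    have h1 : f * h = h * f + (2 : K) • f := by
      rw [← neg_neg ((2 : K) • f), ← neg_smul, ← r]
      abel
    unfold SemiconjBy
    rw [mul_smul_comm, ← mul_assoc, ← cf.eq, mul_assoc, h1, mul_add, mul_smul_comm, smul_add,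
      smul_smul, half_mul_two, one_smul, add_mul, smul_mul_assoc, mul_assoc]
  rw [cartanOf, ← mul_assoc, ← hexp_add, (hexp_semiconj hs).eq]
  exact (((Commute.refl a).mul_right ca).smul_right _).symm

theorem nilOf_mul_nilOf (e f e' f' : B) : nilOf e f * nilOf e' f' =
    hsum fun n => ∑ i ∈ Finset.HasAntidiagonal.antidiagonal n,
      (Uh.Rcoef i.1 * Uh.Rcoef i.2) • (e ^ i.1 * f ^ i.1 * (e' ^ i.2 * f' ^ i.2)) := by
  unfold nilOf
  rw [hsum_mul_hsum]
  simp only [smul_mul_smul_comm]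

theorem cartanOf_neg_neg (h h' : B) : cartanOf (-h) (-h') = cartanOf h h' := by
  rw [cartanOf, neg_mul_neg, cartanOf]

theorem cartanOf_comm {h h' : B} (c : Commute h h') : cartanOf h h' = cartanOf h' h := by
  rw [cartanOf, c.eq, cartanOf]

/-- The Cartan part is unchanged when both arguments change sign, and e has weight -2 for -h, so the
case of a lowering element applies. -/
theorem cartanOf_mul_right' {a h e : B} (r : h * e - e * h = (2 : K) • e) (ca : Commute a h)
    (ce : Commute a e) : cartanOf h a * (hexp (-a) * e) = e * cartanOf h a := by
  rw [cartanOf_comm ca.symm, ← cartanOf_neg_neg]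
  refine cartanOf_mul_right ?_ ca.neg_left.neg_right ce.neg_left
  rw [neg_smul, ← r]
  noncomm_ring

/-- `(Δ ⊗ id)(R) = R₁₃ R₂₃`. -/
theorem Rof_hexagon_left {e1 h1 e2 h2 f3 h3 : B} (r2 : h2 * e2 - e2 * h2 = (2 : K) • e2)
    (r3 : h3 * f3 - f3 * h3 = (-2 : K) • f3) (ce1e2 : Commute e1 e2) (ce1h2 : Commute e1 h2)
    (ch1h2 : Commute h1 h2) (ce1h3 : Commute e1 h3)
    (ch1h3 : Commute h1 h3)
    (ce2f3 : Commute e2 f3) (ch2f3 : Commute h2 f3)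
    (ch2h3 : Commute h2 h3) :
    Rof (e1 * hexp h2 + e2) (h1 + h2) f3 h3 = Rof e1 h1 f3 h3 * Rof e2 h2 f3 h3 := by
  have hc : cartanOf (h1 + h2) h3 = cartanOf h1 h3 * cartanOf h2 h3 := by
    unfold cartanOf
    rw [add_mul, smul_add, hexp_add]
    exact (((ch1h2.mul_right ch1h3).mul_left
      ((ch2h3.symm).mul_right (Commute.refl h3))).smul_left _).smul_right _
  -- In R₁₃R₂₃ the second Cartan factor has to move left past the first nilpotent factor. The price
  -- is e^{ħh₂} on f₃, which becomes the group-like factor in e₁e^{ħh₂} + e₂.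
  have hn : nilOf e1 f3 * cartanOf h2 h3 = cartanOf h2 h3 * nilOf e1 (hexp h2 * f3) := by
    refine (semiconjBy_hsum (u := cartanOf h2 h3) fun n => ?_).symm
    have hf : SemiconjBy (cartanOf h2 h3) (hexp h2 * f3) f3 := cartanOf_mul_right r3 ch2h3 ch2f3
    have he : Commute (cartanOf h2 h3) e1 := (commute_cartanOf ce1h2 ce1h3).symm
    exact (SemiconjBy.mul_right (he.pow_right n) (hf.pow_right n)).smul_right _
  have hk : hexp h2 * e2 = hexp (2 : K) • (e2 * hexp h2) := by
    rw [Uh.hexp_mul_of_rel r2, ← Algebra.ofId_apply, ← map_hexp, Algebra.ofId_apply,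
      ← Algebra.commutes, ← Algebra.smul_def]
  -- The two summands of the coproduct p-commute with p = e^{-2ħ}, so the binomial formula applies
  -- to their sum.
  have hYX : e2 * (e1 * hexp h2) = hexp (-2 : K) • (e1 * hexp h2 * e2) := by
    rw [mul_assoc e1, hk, mul_smul_comm, smul_smul, hexp_neg_mul, one_smul, ← mul_assoc,
      ← ce1e2.eq, mul_assoc]
  have hnn : nilOf e1 (hexp h2 * f3) * nilOf e2 f3 = nilOf (e1 * hexp h2 + e2) f3 := by
    rw [nilOf_mul_nilOf, nilOf]
    congr 1
    funext n
    rw [← smul_mul_assoc, ← Rcoef_binomial hYX, Finset.sum_mul]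
    refine Finset.sum_congr rfl fun i hi => ?_
    rw [smul_mul_assoc, ← Finset.HasAntidiagonal.mem_antidiagonal.1 hi,
      (commute_hexp ch2f3.symm).symm.mul_pow, (commute_hexp ce1h2).mul_pow, pow_add]
    congr 1
    have := (ce2f3.pow_pow i.2 i.1).eq
    simp only [mul_assoc]
    rw [← mul_assoc (f3 ^ i.1), ← this, mul_assoc]
  rw [Rof, Rof, Rof, hc, ← hnn, mul_assoc (cartanOf h1 h3) (nilOf e1 f3), ← mul_assoc (nilOf e1 f3),
    hn]
  simp only [mul_assoc]

/-- Transfers the group-like factor m from the e's to the f's while collecting all e's on the left;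
this is the regrouping of terms in the second hexagon. -/
theorem pow_shuffle {M : Type*} [Monoid M] {e m f g : M} (cm : Commute e m) (cf : Commute e f)
    (cmf : Commute m f) (a b : ℕ) :
    (m * e) ^ a * f ^ a * (e ^ b * g ^ b) = e ^ (a + b) * ((m * f) ^ a * g ^ b) := by
  rw [cm.symm.mul_pow, cmf.mul_pow, ← (cm.pow_pow a a).eq]
  have h : m ^ a * f ^ a * e ^ b = e ^ b * (m ^ a * f ^ a) :=
    ((cm.pow_pow b a).mul_right (cf.pow_pow b a)).eq.symm
  rw [pow_add]
  calc e ^ a * m ^ a * f ^ a * (e ^ b * g ^ b) = e ^ a * (m ^ a * f ^ a * e ^ b) * g ^ b := by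
        simp only [mul_assoc]
    _ = _ := by rw [h]; simp only [mul_assoc]

/-- `(id ⊗ Δ)(R) = R₁₃ R₁₂`. -/
theorem Rof_hexagon_right {e1 h1 f2 h2 f3 h3 : B} (r1 : h1 * e1 - e1 * h1 = (2 : K) • e1)
    (r2 : h2 * f2 - f2 * h2 = (-2 : K) • f2) (ce1h2 : Commute e1 h2)
    (ch1h2 : Commute h1 h2) (ce1f3 : Commute e1 f3)
    (ch1f3 : Commute h1 f3) (ch1h3 : Commute h1 h3) (cf2f3 : Commute f2 f3)
    (ch2f3 : Commute h2 f3) (ch2h3 : Commute h2 h3) :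
    Rof e1 h1 (f2 + hexp (-h2) * f3) (h2 + h3) = Rof e1 h1 f3 h3 * Rof e1 h1 f2 h2 := by
  have hc : cartanOf h1 (h2 + h3) = cartanOf h1 h3 * cartanOf h1 h2 := by
    unfold cartanOf
    rw [add_comm, mul_add, smul_add, hexp_add]
    exact ((((Commute.refl h1).mul_right ch1h2).mul_left
      ((ch1h3.symm).mul_right ch2h3.symm)).smul_left _).smul_right _
  -- This time the Cartan factor shares its first leg with e₁, so e₁ picks up e^{-ħh₂}, the
  -- group-like factor in f₂ + e^{-ħh₂}f₃.
  have hn : nilOf e1 f3 * cartanOf h1 h2 = cartanOf h1 h2 * nilOf (hexp (-h2) * e1) f3 := by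
    refine (semiconjBy_hsum (u := cartanOf h1 h2) fun n => ?_).symm
    have he : SemiconjBy (cartanOf h1 h2) (hexp (-h2) * e1) e1 :=
      cartanOf_mul_right' r1 ch1h2.symm ce1h2.symm
    have hf : Commute (cartanOf h1 h2) f3 := (commute_cartanOf ch1f3.symm ch2f3.symm).symm
    exact ((he.pow_right n).mul_right (hf.pow_right n)).smul_right _
  have hk : f2 * hexp (-h2) = hexp (-2 : K) • (hexp (-h2) * f2) := by
    have r : -h2 * f2 - f2 * -h2 = (2 : K) • f2 := by
      rw [← neg_neg (2 : K), neg_smul, ← r2]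
      noncomm_ring
    rw [Uh.hexp_mul_of_rel r, ← Algebra.ofId_apply, ← map_hexp, Algebra.ofId_apply,
      ← Algebra.commutes, ← Algebra.smul_def, smul_smul, hexp_neg_mul, one_smul]
  have hYX : f2 * (hexp (-h2) * f3) = hexp (-2 : K) • (hexp (-h2) * f3 * f2) := by
    rw [← mul_assoc, hk, smul_mul_assoc, mul_assoc, cf2f3.eq, mul_assoc]
  have hnn : nilOf (hexp (-h2) * e1) f3 * nilOf e1 f2 = nilOf e1 (f2 + hexp (-h2) * f3) := by
    rw [nilOf_mul_nilOf, nilOf]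
    congr 1
    funext n
    -- The p-commutation makes e^{-ħh₂}f₃ the left variable of the binomial formula, so the summands
    -- are exchanged; this is why R₁₃ precedes R₁₂.
    rw [← mul_smul_comm, add_comm f2, ← Rcoef_binomial hYX, Finset.mul_sum]
    refine Finset.sum_congr rfl fun i hi => ?_
    have cm : Commute e1 (hexp (-h2)) := commute_hexp ce1h2.neg_right
    rw [mul_smul_comm, ← Finset.HasAntidiagonal.mem_antidiagonal.1 hi]
    exact congrArg _ (pow_shuffle cm ce1f3 (commute_hexp ch2f3.symm.neg_right).symm i.1 i.2)
  rw [Rof, Rof, Rof, hc, ← hnn, mul_assoc (cartanOf h1 h3) (nilOf e1 f3), ← mul_assoc (nilOf e1 f3),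
    hn]
  simp only [mul_assoc]

theorem Rof_zero_left (f h' : B) : Rof 0 0 f h' = 1 := by
  have h : nilOf 0 f = (1 : B) := by
    rw [nilOf, hsum_succ]
    have h0 : hsum (fun _ : ℕ => (0 : B)) = 0 := by
      simpa using (map_hsum (0 : B →ₗ[K] B) fun _ => (0 : B)).symm
    simp [Rcoef_zero, h0]
  rw [Rof, h, cartanOf, zero_mul, smul_zero, hexp_zero, one_mul]

theorem Rof_zero_right (e h : B) : Rof e h 0 0 = 1 := by
  have h' : nilOf e 0 = (1 : B) := by
    rw [nilOf, hsum_succ]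
    have h0 : hsum (fun _ : ℕ => (0 : B)) = 0 := by
      simpa using (map_hsum (0 : B →ₗ[K] B) fun _ => (0 : B)).symm
    simp [Rcoef_zero, h0]
  rw [Rof, h', cartanOf, mul_zero, smul_zero, hexp_zero, one_mul]

end RMatrix

/-! ## Twisting module algebras -/

section TwistedModuleAlgebra

variable {A : Type*} [Ring A] [Algebra K A]

/-- The coproduct on the first factor, `Δ ⊗ id`. -/
def comulLeft (Δ : A →ₐ[K] CT A A) : CT A A →ₐ[K] CT (CT A A) A := CT.map Δ (AlgHom.id K A)

/-- `a ⊗ b ↦ 1 ⊗ a ⊗ b`. -/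
def legs23 : CT A A →ₐ[K] CT (CT A A) A := CT.map CT.inr (AlgHom.id K A)

theorem inl_inl_commute_legs23 (a : A) (x : CT A A) :
    Commute (CT.inl (CT.inl a) : CT (CT A A) A) (legs23 x) := by
  refine (CT.commute_of (fun b => ?_) (fun b => ?_) x).symm
  · rw [legs23, CT.map_inl]; exact ((CT.inl_commute_inr a b).map CT.inl).symm
  · rw [legs23, CT.map_inr]; exact (CT.inl_commute_inr _ _).symm

/-- The coproduct on the second factor, `id ⊗ Δ`. -/
def comulRight (Δ : A →ₐ[K] CT A A) : CT A A →ₐ[K] CT (CT A A) A :=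
  CT.lift (CT.inl.comp CT.inl) (legs23.comp Δ) fun a b => inl_inl_commute_legs23 a (Δ b)

theorem comulRight_inl (Δ : A →ₐ[K] CT A A) (a : A) :
    comulRight Δ (CT.inl a) = CT.inl (CT.inl a) := CT.lift_inl ..

theorem comulRight_inr (Δ : A →ₐ[K] CT A A) (a : A) :
    comulRight Δ (CT.inr a) = legs23 (Δ a) := CT.lift_inr ..

variable {X : Type*} [AddCommGroup X] [Module K X] [Module A X] [IsScalarTower K A X]
  [IsAdicComplete hbarIdeal X]

/-- `T ↦ μ(μ(T ▷ (x ⊗ y ⊗ z)))`. -/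
def mulAct₃ (μ : X →ₗ[K] X →ₗ[K] X) (x y z : X) : CT (CT A A) A →ₗ[K] X :=
  CT.extend (TensorProduct.lift (μ.compl₁₂ (mulAct μ x y) (orbitMap z)))

theorem mulAct₃_inl_mul_inr (μ : X →ₗ[K] X →ₗ[K] X) (x y z : X) (P : CT A A) (c : A) :
    mulAct₃ μ x y z (CT.inl P * CT.inr c) = μ (mulAct μ x y P) (c • z) := by
  rw [CT.inl_mul_inr, mulAct₃, CT.extend_of, TensorProduct.lift.tmul, LinearMap.compl₁₂_apply,
    orbitMap_apply]

/-- The rightmost factor acts first. Both sides are linear in T with values in an ħ-adic module, so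
pure tensors suffice. -/
theorem mulAct_mul (μ : X →ₗ[K] X →ₗ[K] X) (x y : X) (T : CT A A) (a b : A) :
    mulAct μ x y (T * CT.of (a ⊗ₜ b)) = mulAct μ (a • x) (b • y) T := by
  have h : mulAct μ x y ∘ₗ LinearMap.mulRight K (CT.of (a ⊗ₜ b)) = mulAct μ (a • x) (b • y) := by
    refine CT.hom_ext fun c d => ?_
    rw [LinearMap.comp_apply, LinearMap.mulRight_apply, ← map_mul,
      Algebra.TensorProduct.tmul_mul_tmul, mulAct_of, mulAct_of, mul_smul, mul_smul]
  exact LinearMap.congr_fun h T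

variable {Δ : A →ₐ[K] CT A A} {μ : X →ₗ[K] X →ₗ[K] X}

/-- Covariance for arguments already acted on by T: for pure T it is covariance at the shifted
arguments, and continuity gives the rest. -/
theorem IsModuleAlgebra.smul_mulAct (hμ : IsModuleAlgebra Δ μ) (g : A) (x y : X) (T : CT A A) :
    g • mulAct μ x y T = mulAct μ x y (Δ g * T) := by
  have h : (DistribSMul.toLinearMap K X g) ∘ₗ mulAct μ x y =
      mulAct μ x y ∘ₗ LinearMap.mulLeft K (Δ g) := by
    refine CT.hom_ext fun a b => ?_
    rw [LinearMap.comp_apply, LinearMap.comp_apply, LinearMap.mulLeft_apply, mulAct_mul, mulAct_of,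
      ← hμ.covariant]
    rfl
  exact LinearMap.congr_fun h T

/-- For T = a ⊗ b, covariance moves a inside the inner product as Δ(a), while b acts on z only and
commutes with P on the first two legs. -/
theorem IsModuleAlgebra.mulAct_mulAct_left (hμ : IsModuleAlgebra Δ μ) (x y z : X) (P T : CT A A) :
    mulAct μ (mulAct μ x y P) z T = mulAct₃ μ x y z (comulLeft Δ T * CT.inl P) := by
  have h : mulAct μ (mulAct μ x y P) z =
      mulAct₃ μ x y z ∘ₗ LinearMap.mulRight K (CT.inl P) ∘ₗ (comulLeft Δ).toLinearMap := by
    refine CT.hom_ext fun a b => ?_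
    rw [mulAct_of, hμ.smul_mulAct, ← mulAct₃_inl_mul_inr, LinearMap.comp_apply,
      LinearMap.comp_apply, LinearMap.mulRight_apply, AlgHom.toLinearMap_apply, ← CT.inl_mul_inr,
      map_mul (comulLeft Δ), comulLeft, CT.map_inl, CT.map_inr, AlgHom.id_apply, mul_assoc,
      ← (CT.inl_commute_inr P b).eq, ← mul_assoc, ← map_mul]
  exact LinearMap.congr_fun h T

/-- Associativity of μ enters here. It allows both bracketings of a threefold product to be read off
from the one left-bracketed action `mulAct₃`, without an associator on the tensor cube. -/
theorem IsModuleAlgebra.mulAct₃_legs23 (hμ : IsModuleAlgebra Δ μ) (x y z : X) (a : A)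
    (P : CT A A) :
    mulAct₃ μ x y z (CT.inl (CT.inl a) * legs23 P) = μ (a • x) (mulAct μ y z P) := by
  have h : mulAct₃ μ x y z ∘ₗ LinearMap.mulLeft K (CT.inl (CT.inl a)) ∘ₗ legs23.toLinearMap =
      μ (a • x) ∘ₗ mulAct μ y z := by
    refine CT.hom_ext fun b c => ?_
    rw [LinearMap.comp_apply, LinearMap.comp_apply, LinearMap.comp_apply, LinearMap.mulLeft_apply,
      AlgHom.toLinearMap_apply, ← CT.inl_mul_inr, map_mul legs23, legs23, CT.map_inl, CT.map_inr,
      AlgHom.id_apply, ← mul_assoc, ← map_mul, mulAct₃_inl_mul_inr, CT.inl_mul_inr, CT.inl_mul_inr,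
      mulAct_of, mulAct_of, hμ.assoc]
  exact LinearMap.congr_fun h P

theorem IsModuleAlgebra.mulAct_mulAct_right (hμ : IsModuleAlgebra Δ μ) (x y z : X)
    (P T : CT A A) :
    mulAct μ x (mulAct μ y z P) T = mulAct₃ μ x y z (comulRight Δ T * legs23 P) := by
  have h : mulAct μ x (mulAct μ y z P) =
      mulAct₃ μ x y z ∘ₗ LinearMap.mulRight K (legs23 P) ∘ₗ (comulRight Δ).toLinearMap := by
    refine CT.hom_ext fun a b => ?_
    rw [mulAct_of, hμ.smul_mulAct, ← hμ.mulAct₃_legs23, LinearMap.comp_apply,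
      LinearMap.comp_apply, LinearMap.mulRight_apply, AlgHom.toLinearMap_apply, ← CT.inl_mul_inr,
      map_mul legs23, map_mul (comulRight Δ), comulRight_inl, comulRight_inr, mul_assoc]
  exact LinearMap.congr_fun h T

/-- Twisting a module algebra by a `2`-cocycle. -/
theorem IsModuleAlgebra.twist (hμ : IsModuleAlgebra Δ μ) (J : (CT A A)ˣ)
    (hJ : comulLeft Δ J * CT.inl (J : CT A A) = comulRight Δ J * legs23 (J : CT A A)) :
    IsModuleAlgebra (conjHom J⁻¹ Δ) (twistedMul μ (J : CT A A)) where
  assoc x y z := by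
    simp only [twistedMul_apply]
    -- The two bracketings are `mulAct₃` evaluated at the two sides of the cocycle identity.
    rw [hμ.mulAct_mulAct_left, hμ.mulAct_mulAct_right, hJ]
  covariant g x y := by
    have h (T : CT A A) :
        mulAct (twistedMul μ (J : CT A A)) x y T = mulAct μ x y ((J : CT A A) * T) := by
      have h : mulAct (twistedMul μ (J : CT A A)) x y =
          mulAct μ x y ∘ₗ LinearMap.mulLeft K (J : CT A A) := by
        refine CT.hom_ext fun a b => ?_
        rw [mulAct_of, twistedMul_apply, LinearMap.comp_apply, LinearMap.mulLeft_apply, mulAct_mul]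
      exact LinearMap.congr_fun h T
    have h' : conjHom J⁻¹ Δ g = ↑J⁻¹ * Δ g * J := by
      change ↑J⁻¹ * Δ g * ↑(J⁻¹)⁻¹ = _
      rw [inv_inv]
    -- Acting by the new coproduct inside the twisted product means acting by J·J⁻¹Δ(g)J = Δ(g)J
    -- inside μ.
    rw [h, h', twistedMul_apply, hμ.smul_mulAct, mul_assoc, Units.mul_inv_cancel_left]

/-- A acts on the unit through ε, so J acts on a pair containing the unit through its counit
contraction. -/
theorem IsModuleUnit.twist [IsAdicComplete hbarIdeal A] {ε : A →ₐ[K] K} {one : X}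
    (h : IsModuleUnit ε μ one) {J : CT A A} (hl : counitLeft ε J = 1) (hr : counitRight ε J = 1) :
    IsModuleUnit ε (twistedMul μ J) one where
  one_mul x := by
    have h' : mulAct μ one x = orbitMap x ∘ₗ (counitLeft ε).toLinearMap := by
      refine CT.hom_ext fun a b => ?_
      rw [mulAct_of, h.act_one, map_smul μ, LinearMap.smul_apply, h.one_mul, LinearMap.comp_apply,
        orbitMap_apply, AlgHom.toLinearMap_apply, ← CT.inl_mul_inr, map_mul, counitLeft,
        CT.lift_inl, CT.lift_inr, AlgHom.comp_apply, Algebra.ofId_apply, AlgHom.id_apply,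
        ← Algebra.smul_def, smul_assoc]
    rw [twistedMul_apply, h', LinearMap.comp_apply, orbitMap_apply, AlgHom.toLinearMap_apply, hl,
      one_smul]
  mul_one x := by
    have h' : mulAct μ x one = orbitMap x ∘ₗ (counitRight ε).toLinearMap := by
      refine CT.hom_ext fun a b => ?_
      rw [mulAct_of, h.act_one, map_smul, h.mul_one, LinearMap.comp_apply,
        orbitMap_apply, AlgHom.toLinearMap_apply, ← CT.inl_mul_inr, map_mul, counitRight,
        CT.lift_inl, CT.lift_inr, AlgHom.comp_apply, Algebra.ofId_apply, AlgHom.id_apply,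
        ← Algebra.commutes, ← Algebra.smul_def, smul_assoc]
    rw [twistedMul_apply, h', LinearMap.comp_apply, orbitMap_apply, AlgHom.toLinearMap_apply, hr,
      one_smul]
  act_one := h.act_one

end TwistedModuleAlgebra

/-! ## The twist `R₂₃` -/

namespace Uh

theorem comul_E : comul E = CT.inl E * CT.inr (hexp H) + CT.inr E := lift_E ..

theorem comul_H : comul H = CT.inl H + CT.inr H := lift_H ..

theorem comul_F : comul F = CT.inl F + CT.inl (hexp (-H)) * CT.inr F := lift_F ..

/-- The values of a character of `U_ħ(su₂)` on the generators vanish. -/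
theorem character_eq_zero (χ : Uh →ₐ[K] K) : χ E = 0 ∧ χ H = 0 ∧ χ F = 0 := by
  have h2 : (2 : K) ≠ 0 := fun h2 => by
    have h3 := congrArg PowerSeries.constantCoeff h2
    rw [map_ofNat, map_zero] at h3
    exact two_ne_zero h3
  refine ⟨?_, ?_, ?_⟩
  · have h := congrArg χ rel_HE
    rw [map_sub, map_mul, map_mul, mul_comm, sub_self, map_smul, smul_eq_mul] at h
    exact (mul_eq_zero.1 h.symm).resolve_left h2
  · have h := congrArg χ rel_EF
    rw [map_sub, map_mul, map_mul, mul_comm, sub_self, map_qnum] at h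
    have h' : hsinh (χ H) = 0 := by
      have h4 := congrArg (hsinh (1 : K) * ·) h
      rw [qnum, smul_eq_mul] at h4
      simpa [← mul_assoc, hsinh_mul_inv] using h4.symm
    -- A character kills the commutator [E,F], hence [χ(H)] = 0. The series is χ(H) times a cofactor
    -- with constant coefficient 2, and K is a domain.
    have h5 : hsinh (χ H) = χ H * hsum fun n => invFact (n + 1) * (1 + (-1) ^ n) * χ H ^ n := by
      rw [← LinearMap.mulLeft_apply K, map_hsum, hsinh]
      congr 1
      funext n
      rw [LinearMap.mulLeft_apply, expTerm, expTerm, smul_eq_mul, smul_eq_mul, neg_pow]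
      ring
    refine (mul_eq_zero.1 (h5.symm.trans h')).resolve_right fun h6 => ?_
    have h7 := congrArg PowerSeries.constantCoeff h6
    rw [hsum_succ] at h7
    have h8 : (2 : ℂ) = 0 := by
      rw [← map_ofNat PowerSeries.constantCoeff 2]
      simpa [invFact, one_add_one_eq_two] using h7
    exact two_ne_zero h8
  · have h := congrArg χ rel_HF
    rw [map_sub, map_mul, map_mul, mul_comm, sub_self, map_smul, smul_eq_mul] at h
    exact (mul_eq_zero.1 h.symm).resolve_left (neg_ne_zero.2 h2)

end Uh

namespace So4

theorem R23_eq : (R23 : CT So4 So4) = Rof (CT.inl (CT.inr Uh.E)) (CT.inl (CT.inr Uh.H))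
    (CT.inr (CT.inl Uh.F)) (CT.inr (CT.inl Uh.H)) := by
  change CT.leg23 Uh.R = _
  rw [R_eq_Rof, map_Rof, CT.leg23, CT.map_inl, CT.map_inl, CT.map_inr, CT.map_inr]

theorem comul_inl (a : Uh) : comul (CT.inl a) = CT.leg13 (Uh.comul a) := CT.lift_inl ..

theorem comul_inr (a : Uh) : comul (CT.inr a) = CT.leg24 (Uh.comul a) := CT.lift_inr ..

/-- An arbitrary character is allowed because, after transfer along α' ⊗ α'', the undeformed counit
pulls back to a character not assumed to be the counit of `So4`. Once E and H are sent to 0, only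
the constant term of the R-matrix remains. -/
theorem counitLeft_R23 (ε : So4 →ₐ[K] K) : counitLeft ε (R23 : CT So4 So4) = 1 := by
  obtain ⟨h1, h2, -⟩ := Uh.character_eq_zero (ε.comp CT.inr)
  rw [AlgHom.comp_apply] at h1 h2
  rw [R23_eq, map_Rof, counitLeft, CT.lift_inl, CT.lift_inl, AlgHom.comp_apply, AlgHom.comp_apply,
    h1, h2, map_zero, Rof_zero_left]

theorem counitRight_R23 (ε : So4 →ₐ[K] K) : counitRight ε (R23 : CT So4 So4) = 1 := by
  obtain ⟨-, h2, h3⟩ := Uh.character_eq_zero (ε.comp CT.inl)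
  rw [AlgHom.comp_apply] at h2 h3
  rw [R23_eq, map_Rof, counitRight, CT.lift_inr, CT.lift_inr, AlgHom.comp_apply, AlgHom.comp_apply,
    h2, h3, map_zero, Rof_zero_right]

/-- `R₂₃` satisfies the cocycle identity. -/
theorem R23_cocycle : comulLeft comul (R23 : CT So4 So4) * CT.inl (R23 : CT So4 So4) =
    comulRight comul (R23 : CT So4 So4) * legs23 (R23 : CT So4 So4) := by
  -- The three copies of `So4` have six tensor factors; `i2` to `i5` embed `Uh` in the factors 2 to
  -- 5, the only ones that occur.
  let i2 : Uh →ₐ[K] CT (CT So4 So4) So4 := CT.inl.comp (CT.inl.comp CT.inr)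
  let i3 : Uh →ₐ[K] CT (CT So4 So4) So4 := CT.inl.comp (CT.inr.comp CT.inl)
  let i4 : Uh →ₐ[K] CT (CT So4 So4) So4 := CT.inl.comp (CT.inr.comp CT.inr)
  let i5 : Uh →ₐ[K] CT (CT So4 So4) So4 := CT.inr.comp CT.inl
  have c23 (a b : Uh) : Commute (i2 a) (i3 b) := (CT.inl_commute_inr _ _).map CT.inl
  have c24 (a b : Uh) : Commute (i2 a) (i4 b) := (CT.inl_commute_inr _ _).map CT.inl
  have c25 (a b : Uh) : Commute (i2 a) (i5 b) := CT.inl_commute_inr _ _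
  have c34 (a b : Uh) : Commute (i3 a) (i4 b) :=
    ((CT.inl_commute_inr a b).map CT.inr).map CT.inl
  have c35 (a b : Uh) : Commute (i3 a) (i5 b) := CT.inl_commute_inr _ _
  have c45 (a b : Uh) : Commute (i4 a) (i5 b) := CT.inl_commute_inr _ _
  have rE (i : Uh →ₐ[K] CT (CT So4 So4) So4) :
      i Uh.H * i Uh.E - i Uh.E * i Uh.H = (2 : K) • i Uh.E := by
    rw [← map_mul, ← map_mul, ← map_sub, Uh.rel_HE, map_smul]
  have rF (i : Uh →ₐ[K] CT (CT So4 So4) So4) :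
      i Uh.H * i Uh.F - i Uh.F * i Uh.H = (-2 : K) • i Uh.F := by
    rw [← map_mul, ← map_mul, ← map_sub, Uh.rel_HF, map_smul]
  have h1 : comulLeft comul (R23 : CT So4 So4) =
      Rof (i2 Uh.E) (i2 Uh.H) (i5 Uh.F) (i5 Uh.H) *
        Rof (i4 Uh.E) (i4 Uh.H) (i5 Uh.F) (i5 Uh.H) := by
    rw [← Rof_hexagon_left (rE i4) (rF i5) (c24 _ _) (c24 _ _) (c24 _ _) (c25 _ _) (c25 _ _)
      (c45 _ _) (c45 _ _) (c45 _ _), R23_eq, map_Rof]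
    simp only [comulLeft, CT.map_inl, CT.map_inr, comul_inr, Uh.comul_E, Uh.comul_H, CT.leg24,
      map_add, map_mul, AlgHom.id_apply, i2, i4, i5, AlgHom.comp_apply, map_hexp]
  have h2 : CT.inl (R23 : CT So4 So4) = Rof (i2 Uh.E) (i2 Uh.H) (i3 Uh.F) (i3 Uh.H) := by
    rw [R23_eq, map_Rof]
    rfl
  have h3 : comulRight comul (R23 : CT So4 So4) =
      Rof (i2 Uh.E) (i2 Uh.H) (i5 Uh.F) (i5 Uh.H) *
        Rof (i2 Uh.E) (i2 Uh.H) (i3 Uh.F) (i3 Uh.H) := by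
    rw [← Rof_hexagon_right (rE i2) (rF i3) (c23 _ _) (c23 _ _) (c25 _ _) (c25 _ _)
      (c25 _ _) (c35 _ _) (c35 _ _) (c35 _ _), R23_eq, map_Rof]
    simp only [comulRight, CT.lift_inl, CT.lift_inr, comul_inl, Uh.comul_F, Uh.comul_H, CT.leg13,
      map_add, map_mul, AlgHom.id_apply, i2, i3, i5, AlgHom.comp_apply, map_hexp, CT.map_inl,
      CT.map_inr, legs23, map_neg]
  have h4 : legs23 (R23 : CT So4 So4) = Rof (i4 Uh.E) (i4 Uh.H) (i5 Uh.F) (i5 Uh.H) := by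
    rw [R23_eq, map_Rof]
    simp only [legs23, CT.map_inl, CT.map_inr, AlgHom.id_apply, i4, i5, AlgHom.comp_apply]
  -- R₄₅ and R₂₃ have no leg in common, which is all that separates R₂₅R₄₅R₂₃ from R₂₅R₂₃R₄₅.
  have h5 : Commute (Rof (i4 Uh.E) (i4 Uh.H) (i5 Uh.F) (i5 Uh.H))
      (Rof (i2 Uh.E) (i2 Uh.H) (i3 Uh.F) (i3 Uh.H)) :=
    commute_Rof
      (commute_Rof (c24 _ _) (c24 _ _) (c25 _ _) (c25 _ _)).symm
      (commute_Rof (c24 _ _) (c24 _ _) (c25 _ _) (c25 _ _)).symm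
      (commute_Rof (c34 _ _) (c34 _ _) (c35 _ _) (c35 _ _)).symm
      (commute_Rof (c34 _ _) (c34 _ _) (c35 _ _) (c35 _ _)).symm
  rw [h1, h2, h3, h4, mul_assoc, h5.eq, mul_assoc]

end So4

/-! ## Conjugate linear maps and the R-matrix -/

section ConjugateLinear

theorem conjK_hexp {x : K} (hx : conjK x = x) : conjK (hexp x) = hexp x := by
  have h := addMap_hsum (conjK : K →+* K).toAddMonoidHom
    (fun x => by simp [smul_eq_mul, conjK_hbar]) (fun n => expTerm n x)
  unfold hexp
  simpa [expTerm, conjK_invFact, hx] using h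

theorem conjK_qfact (n : ℕ) : conjK (Uh.qfact n) = Uh.qfact n := by
  have h (m : ℕ) : conjK (qnum (m : K)) = qnum (m : K) := by
    have h1 := congrArg conjK (qnum_spec (m : K))
    have h2 : conjK (hexp (1 : K) - hexp (-1 : K)) = hexp (1 : K) - hexp (-1 : K) := by
      rw [map_sub, conjK_hexp (map_one _), conjK_hexp (by simp)]
    -- Reality of [m] follows from conjugating its defining equation and cancelling this nonzero
    -- real factor.
    have h3 : hexp (1 : K) - hexp (-1 : K) ≠ 0 := by
      rw [← hbar_smul_hsinh]
      refine mul_ne_zero PowerSeries.X_ne_zero fun h0 => ?_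
      have h4 := hsinh_mul_inv
      rw [h0, zero_mul] at h4
      exact zero_ne_one h4
    rw [smul_eq_mul, map_mul, h2, map_sub, conjK_hexp (map_natCast _ _),
      conjK_hexp (by simp), ← qnum_spec (m : K), smul_eq_mul] at h1
    exact mul_left_cancel₀ h3 h1
  unfold Uh.qfact
  rw [map_prod]
  exact Finset.prod_congr rfl fun k _ => h _

theorem conjK_Rcoef (n : ℕ) : conjK (Uh.Rcoef n) = Uh.Rcoef n := by
  have h : conjK (Uh.qfact n)⁻¹ = (Uh.qfact n)⁻¹ := by
    have h1 := Uh.qfact_mul_inv n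
    have h2 := congrArg conjK h1
    rw [map_mul, map_one, conjK_qfact] at h2
    linear_combination (Uh.qfact n)⁻¹ * h2 - conjK (Uh.qfact n)⁻¹ * h1
  rw [Uh.Rcoef, map_mul, map_mul, map_pow, conjK_hexp (map_natCast _ _), conjK_hsinh_one, h]

theorem conjK_half : conjK half = half := by
  have h := congrArg conjK half_mul_two
  rw [map_mul, map_one, Uh.conjK_two] at h
  have h' := half_mul_two
  linear_combination half * h - conjK half * h'

variable {B C : Type*} [Ring B] [Algebra K B] [IsAdicComplete hbarIdeal B]
  [Ring C] [Algebra K C] [IsAdicComplete hbarIdeal C]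

/-- Conjugate linear ring homomorphisms respect R-matrices. -/
theorem conjMap_Rof (φ : B →+* C) (hφ : ∀ (c : K) x, φ (c • x) = conjK c • φ x) (e h f h' : B) :
    φ (Rof e h f h') = Rof (φ e) (φ h) (φ f) (φ h') := by
  have hs (a : ℕ → B) : φ (hsum a) = hsum fun n => φ (a n) :=
    addMap_hsum φ.toAddMonoidHom
      (fun x => by simp only [RingHom.toAddMonoidHom_eq_coe, AddMonoidHom.coe_coe, hφ, conjK_hbar])
      a
  unfold Rof cartanOf nilOf hexp
  rw [map_mul, hs, hs]
  simp only [expTerm, hφ, conjK_invFact, map_pow, map_mul, conjK_half, conjK_Rcoef]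

theorem op_hsum (a : ℕ → B) : MulOpposite.op (hsum a) = hsum fun n => MulOpposite.op (a n) :=
  map_hsum (MulOpposite.opLinearEquiv K (M := B)).toLinearMap a

theorem op_hexp (a : B) : MulOpposite.op (hexp a) = hexp (MulOpposite.op a) := op_hsum _

/-- R-matrices in opposite algebras. -/
theorem Rof_op (e h f h' : B) (c : Commute h h') (c' : Commute e f) :
    Rof (MulOpposite.op e) (MulOpposite.op h) (MulOpposite.op f) (MulOpposite.op h') =
      MulOpposite.op (nilOf e f * cartanOf h h') := by
  rw [MulOpposite.op_mul, nilOf, op_hsum, cartanOf, op_hexp, Rof, cartanOf, nilOf, c.eq]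
  congr 2
  funext n
  rw [(c'.pow_pow n n).eq]
  rfl

/-- The signs cancel in pairs: in the product of the Cartan elements, and as (-1)ⁿ(-1)ⁿ in each
nilpotent term. -/
theorem Rof_neg (e h f h' : B) : Rof (-e) (-h) (-f) (-h') = Rof e h f h' := by
  rw [Rof, Rof, cartanOf_neg_neg, nilOf, nilOf]
  congr 2
  funext n
  congr 1
  rw [neg_pow e, neg_pow f]
  rcases neg_one_pow_eq_or B n with h | h <;> simp [h]

/-- Additive maps on a completed tensor product that commute with `ħ` are determined by their values
on the pure tensors. -/
theorem addHom_ext {A D : Type*} [Ring A] [Algebra K A] [Ring D] [Algebra K D] {N : Type*}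
    [AddCommGroup N] [Module K N] [IsAdicComplete hbarIdeal N] {f g : CT A D →+ N}
    (hf : ∀ x, f (hbar • x) = hbar • f x) (hg : ∀ x, g (hbar • x) = hbar • g x)
    (h : ∀ a b, f (CT.of (a ⊗ₜ b)) = g (CT.of (a ⊗ₜ b))) : f = g := by
  have hpow (k : CT A D →+ N) (hk : ∀ x, k (hbar • x) = hbar • k x) (n : ℕ) (x : CT A D) :
      k (hbar ^ n • x) = hbar ^ n • k x := by
    induction n generalizing x with
    | zero => simp
    | succ n ih => rw [pow_succ, mul_smul, ih, hk, ← mul_smul]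
  have ht (t : A ⊗[K] D) : f (CT.of t) = g (CT.of t) := by
    induction t with
    | zero => simp
    | tmul a b => exact h a b
    | add s t hs ht => simp only [map_add, hs, ht]
  ext x
  refine eq_of_forall_pow fun n => ?_
  -- Modulo ħⁿ every element is an algebraic tensor. Additivity and compatibility with ħ suffice
  -- from here, so conjugate linear maps are covered.
  obtain ⟨t, y, hy⟩ := HC.exists_approx (CT.algEquiv A D x) n
  have hx : x - CT.of t = hbar ^ n • (CT.algEquiv A D).symm y := by
    rw [← map_smul, ← hy, map_sub, AlgEquiv.symm_apply_apply]
    congr 1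
    unfold CT.of
    rw [AlgHom.comp_apply, HC.of_apply]
    rfl
  refine ⟨f ((CT.algEquiv A D).symm y) - g ((CT.algEquiv A D).symm y), ?_⟩
  rw [smul_sub, ← hpow f hf, ← hpow g hg, ← hx, map_sub, map_sub, ht]
  abel

end ConjugateLinear

theorem conjOp_hexp {A : Type*} [Ring A] [Algebra K A] [IsAdicComplete hbarIdeal A] (a : A) :
    ConjOp.op (hexp a) = hexp (ConjOp.op a) := by
  refine (addMap_hsum (ConjOp.addEquiv (A := A)).toAddMonoidHom ConjOp.addEquiv_hbar _).trans ?_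
  unfold hexp
  congr 1
  funext n
  exact ConjOp.op_expTerm _ _

/-! ### Composites of an antipode with a star, and involutions of module algebras -/

section UnwrapHoms

variable {A B : Type*} [Ring A] [Algebra K A] [Ring B] [Algebra K B]

/-- The conjugate linear homomorphism `a ↦ st (S a)` of an antipode and a `*`-structure. -/
def starAntipode (S : A →ₐ[K] Aᵐᵒᵖ) (st : A →ₐ[K] ConjOp A) : A →+* A where
  toFun a := (st (S a).unop).unop
  map_one' := by rw [map_one, MulOpposite.unop_one, map_one]; rfl
  map_mul' a b := by rw [map_mul, MulOpposite.unop_mul, map_mul]; rfl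
  map_zero' := by rw [map_zero, MulOpposite.unop_zero, map_zero]; rfl
  map_add' a b := by rw [map_add, MulOpposite.unop_add, map_add]; rfl

theorem conjOp_unop_smul (c : K) (x : ConjOp A) : (c • x).unop = conjK c • x.unop :=
  congrArg ConjOp.unop (ConjOp.smul_op c x.unop)

theorem starAntipode_smul (S : A →ₐ[K] Aᵐᵒᵖ) (st : A →ₐ[K] ConjOp A) (c : K) (a : A) :
    starAntipode S st (c • a) = conjK c • starAntipode S st a := by
  change (st (S (c • a)).unop).unop = _
  rw [map_smul, MulOpposite.unop_smul, map_smul, conjOp_unop_smul]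
  rfl

variable (S : A →ₐ[K] Aᵐᵒᵖ) (st : A →ₐ[K] ConjOp A)

/-- The map `a ⊗ b ↦ (S b)* ⊗ (S a)*`. -/
def starAntipode₂ : CT A A →+* CT A A := starAntipode (CT.antipode S S) (CT.flipStar st)

theorem starAntipode₂_inl (a : A) :
    starAntipode₂ S st (CT.inl a) = CT.inr (starAntipode S st a) := by
  change (CT.flipStar st (CT.antipode S S (CT.inl a)).unop).unop = _
  rw [CT.antipode, CT.lift_inl]
  change (CT.flipStar st (CT.inl (S a).unop)).unop = _
  rw [CT.flipStar, CT.lift_inl]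
  rfl

theorem starAntipode₂_inr (a : A) :
    starAntipode₂ S st (CT.inr a) = CT.inl (starAntipode S st a) := by
  change (CT.flipStar st (CT.antipode S S (CT.inr a)).unop).unop = _
  rw [CT.antipode, CT.lift_inr]
  change (CT.flipStar st (CT.inr (S a).unop)).unop = _
  rw [CT.flipStar, CT.lift_inr]
  rfl

variable {S st} {X : Type*} [AddCommGroup X] [Module K X] [Module A X] [IsScalarTower K A X]
  [IsAdicComplete hbarIdeal X]

/-- On a pure tensor a ⊗ b the involution reverses the product and replaces the actions of a and b
by those of (Sa)* and (Sb)*; conjugate linearity with ħ real extends this to the completion. -/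
theorem IsModuleStarAlgebra.star_mulAct {Δ : A →ₐ[K] CT A A} {μ : X →ₗ[K] X →ₗ[K] X} {s : X → X}
    (h : IsModuleStarAlgebra Δ (fun a => (S a).unop) (fun a => (st a).unop) μ s) (x y : X)
    (T : CT A A) : s (mulAct μ x y T) = mulAct μ (s y) (s x) (starAntipode₂ S st T) := by
  let s' : X →+ X := AddMonoidHom.mk' s h.star_add
  have key : s'.comp (mulAct (A := A) μ x y).toAddMonoidHom =
      (mulAct μ (s y) (s x)).toAddMonoidHom.comp (starAntipode₂ S st).toAddMonoidHom := by
    refine addHom_ext (fun T => ?_) (fun T => ?_) fun a b => ?_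
    · change s (mulAct μ x y (hbar • T)) = hbar • s (mulAct μ x y T)
      rw [map_smul, h.star_smul, conjK_hbar]
    · change mulAct μ (s y) (s x) (starAntipode₂ S st (hbar • T)) =
        hbar • mulAct μ (s y) (s x) (starAntipode₂ S st T)
      rw [starAntipode₂, starAntipode_smul, conjK_hbar, map_smul]
    · change s (mulAct μ x y (CT.of (a ⊗ₜ b))) =
        mulAct μ (s y) (s x) (starAntipode₂ S st (CT.of (a ⊗ₜ b)))
      rw [mulAct_of, h.star_mul, h.star_act, h.star_act, ← CT.inl_mul_inr, map_mul,
        starAntipode₂_inl, starAntipode₂_inr, (CT.inl_commute_inr _ _).symm.eq, CT.inl_mul_inr,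
        mulAct_of]
      rfl
  exact DFunLike.congr_fun key T

end UnwrapHoms

/-! ### The map a ↦ (Sa)* on the generators -/

namespace Uh

theorem starHom_E : starHom E = ConjOp.op (F * hexp H) := lift_E ..

theorem starHom_H : starHom H = ConjOp.op H := lift_H ..

theorem starHom_F : starHom F = ConjOp.op (hexp (-H) * E) := lift_F ..

theorem antipode_E : antipode E = MulOpposite.op (-(E * hexp (-H))) := lift_E ..

theorem antipode_H : antipode H = MulOpposite.op (-H) := lift_H ..

theorem antipode_F : antipode F = MulOpposite.op (-(hexp H * F)) := lift_F ..

/-- The scalar `e^{-2ħ}`. -/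
def z : K := hexp (-2)

theorem hexp_algebraMap_eq : hexp (algebraMap K Uh (-2)) = algebraMap K Uh z := by
  rw [← Algebra.ofId_apply, ← map_hexp, Algebra.ofId_apply, z]

theorem conj_E : hexp (-H) * E * hexp H = z • E := by
  rw [rel_mE, hexp_algebraMap_eq, ← Algebra.commutes, ← Algebra.smul_def, smul_mul_assoc, mul_assoc,
    hexp_neg_mul, mul_one]

/-- Conjugation by e^{-ħH} scales F by the inverse of the factor for E; this form avoids writing the
inverse of `z`. -/
theorem conj_F : z • (hexp (-H) * F * hexp H) = F := by
  have h : hexp H * F = z • (F * hexp H) := by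
    rw [rel_kF, hexp_algebraMap_eq, ← Algebra.commutes, ← Algebra.smul_def]
  rw [mul_assoc, ← mul_smul_comm, ← h, ← mul_assoc, hexp_neg_mul, one_mul]

/-- The map `a ↦ (S a)*` on `U_ħ(su₂)`. -/
abbrev sigma : Uh →+* Uh := starAntipode antipode starHom

theorem sigma_E : sigma E = -(hexp (-H) * F * hexp H) := by
  change (starHom (antipode E).unop).unop = _
  rw [antipode_E, MulOpposite.unop_op, map_neg, map_mul, map_hexp, map_neg, starHom_E, starHom_H,
    ← ConjOp.op_neg, ← conjOp_hexp, ← ConjOp.op_mul, ← ConjOp.op_neg, mul_assoc]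

theorem sigma_H : sigma H = -H := by
  change (starHom (antipode H).unop).unop = _
  rw [antipode_H, MulOpposite.unop_op, map_neg, starHom_H, ← ConjOp.op_neg]

theorem sigma_F : sigma F = -(z • E) := by
  change (starHom (antipode F).unop).unop = _
  rw [antipode_F, MulOpposite.unop_op, map_neg, map_mul, map_hexp, starHom_F, starHom_H,
    ← conjOp_hexp, ← ConjOp.op_mul, ← ConjOp.op_neg, conj_E]

end Uh

/-! ### Compatibility of the R-matrix with the flipped star -/

namespace So4

/-- The R-matrix `R₂₃` is preserved by `a ⊗ b ↦ (S b)* ⊗ (S a)*`. -/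
theorem starAntipode₂_R23 :
    starAntipode₂ (CT.antipode Uh.antipode Uh.antipode) (CT.flipStar Uh.starHom)
      (R23 : CT So4 So4) = R23 := by
  have hl (a : Uh) : starAntipode (CT.antipode Uh.antipode Uh.antipode) (CT.flipStar Uh.starHom)
      (CT.inl a) = CT.inr (Uh.sigma a) := starAntipode₂_inl ..
  have hr (a : Uh) : starAntipode (CT.antipode Uh.antipode Uh.antipode) (CT.flipStar Uh.starHom)
      (CT.inr a) = CT.inl (Uh.sigma a) := starAntipode₂_inr ..
  have hs := starAntipode_smul (CT.antipode (CT.antipode Uh.antipode Uh.antipode)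
    (CT.antipode Uh.antipode Uh.antipode)) (CT.flipStar (CT.flipStar Uh.starHom))
  rw [R23_eq, starAntipode₂, conjMap_Rof _ hs, ← starAntipode₂]
  simp only [starAntipode₂_inl, starAntipode₂_inr, hl, hr]
  -- The flips, of the two copies of `So4` and inside each copy, exchange legs 2 and 3. Then E on
  -- leg 2 becomes -z⁻¹F on leg 3, F on leg 3 becomes -zE on leg 2, and H changes sign and leg. The
  -- signs cancel by `Rof_neg`, the powers of z cancel termwise, and distinct legs commute.
  rw [Uh.sigma_E, Uh.sigma_H, Uh.sigma_F]
  simp only [map_neg]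
  rw [Rof_neg, Rof, Rof, cartanOf_comm (CT.inl_commute_inr _ _)]
  congr 1
  rw [nilOf, nilOf]
  congr 1
  funext n
  congr 1
  have h : CT.inr (CT.inl Uh.F) = Uh.z • (CT.inr (CT.inl (hexp (-Uh.H) * Uh.F * hexp Uh.H)) :
      CT So4 So4) := by
    rw [← map_smul, ← map_smul, Uh.conj_F]
  rw [h, smul_pow, mul_smul_comm, map_smul, map_smul, smul_pow, mul_smul_comm]
  congr 1
  exact ((CT.inl_commute_inr _ _).pow_pow n n).eq.symm

theorem R21_eq : (R21 : So4) = Rof (CT.inr Uh.E) (CT.inr Uh.H) (CT.inl Uh.F) (CT.inl Uh.H) := by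
  change CT.flip Uh.R = _
  rw [R_eq_Rof, map_Rof]
  simp only [CT.flip, CT.lift_inl, CT.lift_inr]

theorem flipStar_mul (a b : So4) : flipStar (a * b) = flipStar b * flipStar a :=
  congrArg ConjOp.unop (map_mul (CT.flipStar Uh.starHom) a b)

theorem flipStar_one : flipStar 1 = 1 :=
  congrArg ConjOp.unop (map_one (CT.flipStar Uh.starHom))

/-- The flipped `*`-structure, as a homomorphism to the opposite algebra. -/
def flipStarOp : So4 →+* So4ᵐᵒᵖ where
  toFun a := MulOpposite.op (flipStar a)
  map_one' := by rw [flipStar_one]; rfl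
  map_mul' a b := by rw [flipStar_mul]; rfl
  map_zero' := by
    change MulOpposite.op (CT.flipStar Uh.starHom 0).unop = 0
    rw [map_zero]; rfl
  map_add' a b := by
    change MulOpposite.op (CT.flipStar Uh.starHom (a + b)).unop = _
    rw [map_add]; rfl

theorem flipStarOp_smul (c : K) (a : So4) : flipStarOp (c • a) = conjK c • flipStarOp a := by
  change MulOpposite.op (CT.flipStar Uh.starHom (c • a)).unop = _
  rw [map_smul, conjOp_unop_smul]
  rfl

theorem flipStarOp_inl (a : Uh) :
    flipStarOp (CT.inl a) = MulOpposite.op (CT.inr (Uh.starHom a).unop) := by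
  change MulOpposite.op (CT.flipStar Uh.starHom (CT.inl a)).unop = _
  rw [CT.flipStar, CT.lift_inl]
  rfl

theorem flipStarOp_inr (a : Uh) :
    flipStarOp (CT.inr a) = MulOpposite.op (CT.inl (Uh.starHom a).unop) := by
  change MulOpposite.op (CT.flipStar Uh.starHom (CT.inr a)).unop = _
  rw [CT.flipStar, CT.lift_inr]
  rfl

/-- Moving the Cartan part through `E ⊗ F`. -/
theorem cartanOf_mul_EF :
    SemiconjBy (cartanOf (CT.inr Uh.H) (CT.inl Uh.H) : So4) (CT.inr Uh.E * CT.inl Uh.F)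
      (CT.inl (Uh.F * hexp Uh.H) * CT.inr (hexp (-Uh.H) * Uh.E)) := by
  have hH : Commute (CT.inl Uh.H : So4) (CT.inr Uh.H) := CT.inl_commute_inr _ _
  have hF : cartanOf (CT.inr Uh.H) (CT.inl Uh.H) * (CT.inr (hexp Uh.H) * CT.inl Uh.F) =
      (CT.inl Uh.F * cartanOf (CT.inr Uh.H) (CT.inl Uh.H) : So4) := by
    rw [map_hexp]
    refine cartanOf_mul_right ?_ hH.symm (CT.inl_commute_inr _ _).symm
    rw [← map_mul, ← map_mul, ← map_sub, Uh.rel_HF, map_smul]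
  have hE : cartanOf (CT.inr Uh.H) (CT.inl Uh.H) * (CT.inl (hexp (-Uh.H)) * CT.inr Uh.E) =
      (CT.inr Uh.E * cartanOf (CT.inr Uh.H) (CT.inl Uh.H) : So4) := by
    rw [map_hexp, map_neg]
    refine cartanOf_mul_right' ?_ hH (CT.inl_commute_inr _ _)
    rw [← map_mul, ← map_mul, ← map_sub, Uh.rel_HE, map_smul]
  have hk : Commute (cartanOf (CT.inr Uh.H) (CT.inl Uh.H) : So4) (CT.inl (hexp Uh.H)) := by
    rw [map_hexp]
    exact commute_hexp (commute_cartanOf hH (Commute.refl _)).symm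
  have hm : Commute (cartanOf (CT.inr Uh.H) (CT.inl Uh.H) : So4) (CT.inr (hexp (-Uh.H))) := by
    rw [map_hexp, map_neg]
    exact commute_hexp (commute_cartanOf (Commute.refl _) hH.symm).symm.neg_right
  have hF' : (CT.inl (hexp (-Uh.H)) * CT.inl Uh.F * CT.inl (hexp Uh.H) : So4) =
      CT.inl (hexp (-Uh.H) * Uh.F * hexp Uh.H) := by
    rw [map_mul, map_mul]
  have hE' : (CT.inr (hexp (-Uh.H)) * CT.inr Uh.E * CT.inr (hexp Uh.H) : So4) =
      Uh.z • CT.inr Uh.E := by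
    rw [← map_mul, ← map_mul, Uh.conj_E, map_smul]
  -- Simultaneous conjugation by e^{-ħH} in both legs fixes the product, as the scalars z and z⁻¹
  -- cancel. Regrouped, it displays e^{-ħH}E and e^{ħH}F, each with the exponential in the other
  -- leg, in the form that the Cartan part absorbs.
  have hEF : (CT.inr Uh.E * CT.inl Uh.F : So4) =
      CT.inr (hexp (-Uh.H)) * (CT.inl (hexp (-Uh.H)) * CT.inr Uh.E) *
        (CT.inr (hexp Uh.H) * CT.inl Uh.F) * CT.inl (hexp Uh.H) := by
    have h1 : (CT.inl Uh.F : So4) = Uh.z • CT.inl (hexp (-Uh.H) * Uh.F * hexp Uh.H) := by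
      rw [← map_smul, Uh.conj_F]
    have h2 : (CT.inr (hexp (-Uh.H)) * (CT.inl (hexp (-Uh.H)) * CT.inr Uh.E) *
        (CT.inr (hexp Uh.H) * CT.inl Uh.F) * CT.inl (hexp Uh.H) : So4) =
        (CT.inr (hexp (-Uh.H)) * CT.inr Uh.E * CT.inr (hexp Uh.H)) *
        (CT.inl (hexp (-Uh.H)) * CT.inl Uh.F * CT.inl (hexp Uh.H)) := by
      rw [(CT.inl_commute_inr (hexp (-Uh.H)) Uh.E).eq]
      simp only [mul_assoc]
      rw [← mul_assoc (CT.inl (hexp (-Uh.H))) (CT.inr (hexp Uh.H)),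
        (CT.inl_commute_inr (hexp (-Uh.H)) (hexp Uh.H)).eq, mul_assoc]
    rw [h2, hF', hE', smul_mul_assoc, ← mul_smul_comm, ← h1]
  have key : SemiconjBy (cartanOf (CT.inr Uh.H) (CT.inl Uh.H) : So4)
      (CT.inr (hexp (-Uh.H)) * (CT.inl (hexp (-Uh.H)) * CT.inr Uh.E) *
        (CT.inr (hexp Uh.H) * CT.inl Uh.F) * CT.inl (hexp Uh.H))
      (CT.inr (hexp (-Uh.H)) * CT.inr Uh.E * CT.inl Uh.F * CT.inl (hexp Uh.H)) :=
    ((SemiconjBy.mul_right hm hE).mul_right hF).mul_right hk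
  rwa [← hEF, ← map_mul, mul_assoc _ (CT.inl Uh.F), ← map_mul,
    ← (CT.inl_commute_inr (Uh.F * hexp Uh.H) _).eq] at key

/-- The star reverses the Cartan and nilpotent parts and turns E, F into Fe^{ħH}, e^{-ħH}E. Moving
the Cartan part back to the left removes these exponentials. -/
theorem flipStar_R21 : flipStar R21 = R21 := by
  have h : MulOpposite.op (flipStar R21) = MulOpposite.op (R21 : So4) := by
    change flipStarOp R21 = _
    rw [R21_eq, conjMap_Rof _ flipStarOp_smul]
    simp only [flipStarOp_inl, flipStarOp_inr]
    rw [Uh.starHom_E, Uh.starHom_H, Uh.starHom_F,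
      Rof_op _ _ _ _ (CT.inl_commute_inr _ _) (CT.inl_commute_inr _ _), Rof]
    congr 1
    rw [cartanOf_comm (CT.inl_commute_inr _ _)]
    refine (semiconjBy_hsum fun n => ?_).symm
    refine SemiconjBy.smul_right ?_ _
    rw [← (CT.inl_commute_inr _ _).mul_pow, ← (CT.inl_commute_inr _ _).symm.mul_pow]
    exact cartanOf_mul_EF.pow_right n
  exact MulOpposite.op_injective h

theorem flipStar_R21_inv : flipStar ↑R21⁻¹ = ↑R21⁻¹ := by
  have h : flipStar ↑R21⁻¹ * R21 = 1 := by
    have h' : flipStar ↑R21⁻¹ * flipStar R21 = 1 := by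
      rw [← flipStar_mul, Units.mul_inv, flipStar_one]
    rwa [flipStar_R21] at h'
  rw [← Units.mul_inv_cancel_right (flipStar ↑R21⁻¹) R21, h, one_mul]

end So4

/-- Since R₂₁ is self-adjoint, starring its conjugation in the antipode gives the inverse
conjugation, which the one in the Lorentz star undoes. The condition on (g ▷ x)* is therefore the
same for both Hopf algebras. -/
theorem Lorentz.star_antipode (g : So4) :
    Lorentz.star (Lorentz.antipode g) = So4.flipStar (So4.antipode g) := by
  rw [Lorentz.star, Lorentz.antipode, So4.flipStar_mul, So4.flipStar_mul, So4.flipStar_R21,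
    So4.flipStar_R21_inv]
  simp only [mul_assoc, Units.mul_inv, mul_one, Units.mul_inv_cancel_left]

theorem lorentz_isModuleStarAlgebra {X : Type*} [AddCommGroup X] [Module K X]
    [IsAdicComplete hbarIdeal X] [Module So4 X] [IsScalarTower K So4 X] {μ : X →ₗ[K] X →ₗ[K] X}
    {s : X → X} (h : IsModuleStarAlgebra So4.comul So4.antipode So4.flipStar μ s) :
    IsModuleStarAlgebra Lorentz.comul Lorentz.antipode Lorentz.star
      (twistedMul μ (So4.R23 : CT So4 So4)) s where
  toIsModuleAlgebra := h.toIsModuleAlgebra.twist So4.R23 So4.R23_cocycle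
  star_add := h.star_add
  star_smul := h.star_smul
  star_mul x y := by
    rw [twistedMul_apply, twistedMul_apply,
      IsModuleStarAlgebra.star_mulAct (S := CT.antipode Uh.antipode Uh.antipode)
        (st := CT.flipStar Uh.starHom) h, So4.starAntipode₂_R23]
  star_star := h.star_star
  star_act g x := by rw [h.star_act, Lorentz.star_antipode]

/-! ## Twists -/

universe u

section Tensor

variable {A B A' B' : Type u} [Ring A] [Algebra K A] [Ring B] [Algebra K B] [Ring A'] [Algebra K A']
  [Ring B'] [Algebra K B']

theorem conjHom_apply (u : Bˣ) (f : A →ₐ[K] B) (a : A) : conjHom u f a = u * f a * ↑u⁻¹ := rfl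

theorem coe_F13 (F : (CT A A)ˣ) : ((F13 F : (CT (CT A B) (CT A B))ˣ) : CT (CT A B) (CT A B)) =
    CT.leg13 (F : CT A A) := Units.coe_map _ _

theorem coe_F13_inv (F : (CT A A)ˣ) :
    (((F13 F)⁻¹ : (CT (CT A B) (CT A B))ˣ) : CT (CT A B) (CT A B)) =
      CT.leg13 ((F⁻¹ : (CT A A)ˣ) : CT A A) := by
  rw [F13, ← map_inv, Units.coe_map]
  rfl

theorem coe_F24 (F : (CT B B)ˣ) : ((F24 F : (CT (CT A B) (CT A B))ˣ) : CT (CT A B) (CT A B)) =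
    CT.leg24 (F : CT B B) := Units.coe_map _ _

theorem coe_F24_inv (F : (CT B B)ˣ) :
    (((F24 F)⁻¹ : (CT (CT A B) (CT A B))ˣ) : CT (CT A B) (CT A B)) =
      CT.leg24 ((F⁻¹ : (CT B B)ˣ) : CT B B) := by
  rw [F24, ← map_inv, Units.coe_map]
  rfl

theorem comul_inl (ΔA : A →ₐ[K] CT A A) (ΔB : B →ₐ[K] CT B B) (a : A) :
    CT.comul ΔA ΔB (CT.inl a) = CT.leg13 (ΔA a) := CT.lift_inl ..

theorem comul_inr (ΔA : A →ₐ[K] CT A A) (ΔB : B →ₐ[K] CT B B) (b : B) :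
    CT.comul ΔA ΔB (CT.inr b) = CT.leg24 (ΔB b) := CT.lift_inr ..

theorem congr_inl (α : A ≃ₐ[K] A') (β : B ≃ₐ[K] B') (a : A) :
    (CT.congr α β).toAlgHom (CT.inl a) = CT.inl (α a) := CT.map_inl ..

theorem congr_inr (α : A ≃ₐ[K] A') (β : B ≃ₐ[K] B') (b : B) :
    (CT.congr α β).toAlgHom (CT.inr b) = CT.inr (β b) := CT.map_inr ..

theorem congr_symm_inl (α : A ≃ₐ[K] A') (β : B ≃ₐ[K] B') (a : A') :
    (CT.congr α β).symm (CT.inl a) = CT.inl (α.symm a) := CT.map_inl ..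

theorem congr_symm_inr (α : A ≃ₐ[K] A') (β : B ≃ₐ[K] B') (b : B') :
    (CT.congr α β).symm (CT.inr b) = CT.inr (β.symm b) := CT.map_inr ..

theorem map_congr_leg13 (α : A ≃ₐ[K] A') (β : B ≃ₐ[K] B') (x : CT A A) :
    CT.map (CT.congr α β).toAlgHom (CT.congr α β).toAlgHom (CT.leg13 x) =
      CT.leg13 (CT.map α.toAlgHom α.toAlgHom x) := by
  have h : (CT.map (CT.congr α β).toAlgHom (CT.congr α β).toAlgHom).comp CT.leg13 =
      CT.leg13.comp (CT.map α.toAlgHom α.toAlgHom) := by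
    refine CT.algHom_ext (fun a => ?_) fun a => ?_
    · rw [AlgHom.comp_apply, AlgHom.comp_apply, CT.leg13, CT.map_inl, CT.map_inl, congr_inl,
        CT.map_inl, CT.leg13, CT.map_inl]
      rfl
    · rw [AlgHom.comp_apply, AlgHom.comp_apply, CT.leg13, CT.map_inr, CT.map_inr, congr_inl,
        CT.map_inr, CT.leg13, CT.map_inr]
      rfl
  rw [← AlgHom.comp_apply, h, AlgHom.comp_apply]

theorem map_congr_leg24 (α : A ≃ₐ[K] A') (β : B ≃ₐ[K] B') (x : CT B B) :
    CT.map (CT.congr α β).toAlgHom (CT.congr α β).toAlgHom (CT.leg24 x) =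
      CT.leg24 (CT.map β.toAlgHom β.toAlgHom x) := by
  have h : (CT.map (CT.congr α β).toAlgHom (CT.congr α β).toAlgHom).comp CT.leg24 =
      CT.leg24.comp (CT.map β.toAlgHom β.toAlgHom) := by
    refine CT.algHom_ext (fun a => ?_) fun a => ?_
    · rw [AlgHom.comp_apply, AlgHom.comp_apply, CT.leg24, CT.map_inl, CT.map_inl, congr_inr,
        CT.map_inl, CT.leg24, CT.map_inl]
      rfl
    · rw [AlgHom.comp_apply, AlgHom.comp_apply, CT.leg24, CT.map_inr, CT.map_inr, congr_inr,
        CT.map_inr, CT.leg24, CT.map_inr]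
      rfl
  rw [← AlgHom.comp_apply, h, AlgHom.comp_apply]

theorem transfer_apply (α : A ≃ₐ[K] A') (Δ : A →ₐ[K] CT A A) (a : A') :
    transfer α Δ a = CT.map α.toAlgHom α.toAlgHom (Δ (α.symm a)) := rfl

theorem transfer_comul (α : A ≃ₐ[K] A') (β : B ≃ₐ[K] B') (ΔA : A →ₐ[K] CT A A)
    (ΔB : B →ₐ[K] CT B B) :
    transfer (CT.congr α β) (CT.comul ΔA ΔB) = CT.comul (transfer α ΔA) (transfer β ΔB) := by
  refine CT.algHom_ext (fun a => ?_) fun b => ?_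
  · rw [transfer_apply, congr_symm_inl, comul_inl, comul_inl, map_congr_leg13, transfer_apply]
  · rw [transfer_apply, congr_symm_inr, comul_inr, comul_inr, map_congr_leg24, transfer_apply]

theorem coe_transferUnit_inv (α : A ≃ₐ[K] A') (T : (CT A A)ˣ) :
    (((transferUnit α T)⁻¹ : (CT A' A')ˣ) : CT A' A') =
      CT.map α.toAlgHom α.toAlgHom ((T⁻¹ : (CT A A)ˣ) : CT A A) := by
  rw [transferUnit, ← map_inv, Units.coe_map]
  rfl

theorem coe_transferUnit (α : A ≃ₐ[K] A') (T : (CT A A)ˣ) :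
    ((transferUnit α T : (CT A' A')ˣ) : CT A' A') = CT.map α.toAlgHom α.toAlgHom (T : CT A A) :=
  Units.coe_map _ _

/-- Transports the definition of the Lorentz coproduct as a conjugate of the Euclidean one to the
undeformed algebra. -/
theorem transfer_conjHom (α : A ≃ₐ[K] A') (Δ : A →ₐ[K] CT A A) (T : (CT A A)ˣ) :
    transfer α (conjHom T Δ) = conjHom (transferUnit α T) (transfer α Δ) := by
  ext a
  rw [conjHom_apply, transfer_apply, transfer_apply, conjHom_apply, map_mul, map_mul,
    coe_transferUnit, coe_transferUnit_inv]

theorem transferUnit_inv (α : A ≃ₐ[K] A') (T : (CT A A)ˣ) :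
    transferUnit α T⁻¹ = (transferUnit α T)⁻¹ := map_inv _ _

theorem map_inv_eq_one (f : A →ₐ[K] B) {T : Aˣ} (h : f T = 1) : f ↑T⁻¹ = 1 := by
  have h1 := congrArg f T.mul_inv
  rwa [map_mul, h, one_mul, map_one] at h1

end Tensor

section Twists

variable {A B : Type u} [Ring A] [Algebra K A] [IsAdicComplete hbarIdeal A] [Ring B] [Algebra K B]
  [IsAdicComplete hbarIdeal B]

/-- Each tensor factor sees only its own twist, because legs 13 and 24 commute; the counit
contractions likewise factor through the two legs. -/
theorem IsTwist.tensor {ΔA ΔA' : A →ₐ[K] CT A A} {ΔB ΔB' : B →ₐ[K] CT B B} {εA : A →ₐ[K] K}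
    {εB : B →ₐ[K] K} {F : (CT A A)ˣ} {G : (CT B B)ˣ} (hF : IsTwist ΔA εA ΔA' F)
    (hG : IsTwist ΔB εB ΔB' G) :
    IsTwist (CT.comul ΔA ΔB) (CT.counit εA εB) (CT.comul ΔA' ΔB')
      (F13 F * F24 G : (CT (CT A B) (CT A B))ˣ) where
  counit_left := by
    have h1 : (counitLeft (CT.counit εA εB)).comp CT.leg13 = CT.inl.comp (counitLeft εA) := by
      refine CT.algHom_ext (fun a => ?_) fun a => ?_ <;>
        simp [CT.leg13, counitLeft, CT.counit, Algebra.ofId_apply]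
    have h2 : (counitLeft (CT.counit εA εB)).comp CT.leg24 = CT.inr.comp (counitLeft εB) := by
      refine CT.algHom_ext (fun a => ?_) fun a => ?_ <;>
        simp [CT.leg24, counitLeft, CT.counit, Algebra.ofId_apply]
    have h3 := DFunLike.congr_fun h1 (F : CT A A)
    have h4 := DFunLike.congr_fun h2 (G : CT B B)
    rw [AlgHom.comp_apply, AlgHom.comp_apply, hF.counit_left, map_one] at h3
    rw [AlgHom.comp_apply, AlgHom.comp_apply, hG.counit_left, map_one] at h4
    rw [Units.val_mul, coe_F13, coe_F24, map_mul, h3, h4, one_mul]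
  counit_right := by
    have h1 : (counitRight (CT.counit εA εB)).comp CT.leg13 = CT.inl.comp (counitRight εA) := by
      refine CT.algHom_ext (fun a => ?_) fun a => ?_ <;>
        simp [CT.leg13, counitRight, CT.counit, Algebra.ofId_apply]
    have h2 : (counitRight (CT.counit εA εB)).comp CT.leg24 = CT.inr.comp (counitRight εB) := by
      refine CT.algHom_ext (fun a => ?_) fun a => ?_ <;>
        simp [CT.leg24, counitRight, CT.counit, Algebra.ofId_apply]
    have h3 := DFunLike.congr_fun h1 (F : CT A A)
    have h4 := DFunLike.congr_fun h2 (G : CT B B)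
    rw [AlgHom.comp_apply, AlgHom.comp_apply, hF.counit_right, map_one] at h3
    rw [AlgHom.comp_apply, AlgHom.comp_apply, hG.counit_right, map_one] at h4
    rw [Units.val_mul, coe_F13, coe_F24, map_mul, h3, h4, one_mul]
  comul_eq g := by
    -- Both sides are homomorphisms, so agreement on A ⊗ 1 and 1 ⊗ B is enough. On A ⊗ 1 the
    -- conjugation by G₂₄ is trivial, on 1 ⊗ B the one by F₁₃.
    have h : CT.comul ΔA' ΔB' = conjHom (F13 F * F24 G) (CT.comul ΔA ΔB) := by
      refine CT.algHom_ext (fun a => ?_) fun b => ?_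
      · rw [conjHom_apply, comul_inl, comul_inl, hF.comul_eq, mul_inv_rev, Units.val_mul,
          Units.val_mul, map_mul, map_mul]
        have h1 : Commute ((F24 G : (CT (CT A B) (CT A B))ˣ) : CT (CT A B) (CT A B))
            (CT.leg13 (ΔA a)) := (CT.leg13_commute_leg24 (ΔA a) (G : CT B B)).symm
        rw [mul_assoc ((F13 F : (CT (CT A B) (CT A B))ˣ) : CT (CT A B) (CT A B)), h1.eq, ← mul_assoc,
          ← mul_assoc, Units.mul_inv_cancel_right, coe_F13, coe_F13_inv]
      · rw [conjHom_apply, comul_inr, comul_inr, mul_inv_rev, Units.val_mul, Units.val_mul,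
          hG.comul_eq]
        have h1 : Commute ((F13 F : (CT (CT A B) (CT A B))ˣ) : CT (CT A B) (CT A B))
            (CT.leg24 ((G : CT B B) * ΔB b * ↑G⁻¹)) := CT.leg13_commute_leg24 (F : CT A A) _
        rw [← Units.mul_inv_cancel_right (CT.leg24 (_ * _ * _)) (F13 F), ← h1.eq,
          map_mul, map_mul, coe_F24, coe_F24_inv]
        simp only [mul_assoc]
    rw [h, conjHom_apply]

/-- The composition of a twist with the conjugation by an invertible counital element. -/
theorem IsTwist.mul {Δ Δ' : A →ₐ[K] CT A A} {ε : A →ₐ[K] K} {F : (CT A A)ˣ}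
    (hF : IsTwist Δ ε Δ' F) (T : (CT A A)ˣ) (hl : counitLeft ε T = 1) (hr : counitRight ε T = 1) :
    IsTwist Δ ε (conjHom T Δ') (T * F) where
  counit_left := by rw [Units.val_mul, map_mul, hl, hF.counit_left, one_mul]
  counit_right := by rw [Units.val_mul, map_mul, hr, hF.counit_right, one_mul]
  comul_eq g := by
    rw [conjHom_apply, hF.comul_eq, mul_inv_rev, Units.val_mul, Units.val_mul]
    simp only [mul_assoc]

variable {A' : Type u} [Ring A'] [Algebra K A'] [IsAdicComplete hbarIdeal A']

/-- Naturality of the contraction; the character on the source is ε ∘ α, whatever the counit there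
may be. -/
theorem counitLeft_transferUnit (α : A ≃ₐ[K] A') (ε : A' →ₐ[K] K) (T : (CT A A)ˣ) :
    counitLeft ε (transferUnit α T : CT A' A') = α (counitLeft (ε.comp α.toAlgHom) T) := by
  have h : (counitLeft ε).comp (CT.map α.toAlgHom α.toAlgHom) =
      α.toAlgHom.comp (counitLeft (ε.comp α.toAlgHom)) := by
    refine CT.algHom_ext (fun a => ?_) fun a => ?_ <;> simp [counitLeft, Algebra.ofId_apply]
  have h' := DFunLike.congr_fun h (T : CT A A)
  rwa [AlgHom.comp_apply, AlgHom.comp_apply, ← coe_transferUnit] at h'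

theorem counitRight_transferUnit (α : A ≃ₐ[K] A') (ε : A' →ₐ[K] K) (T : (CT A A)ˣ) :
    counitRight ε (transferUnit α T : CT A' A') = α (counitRight (ε.comp α.toAlgHom) T) := by
  have h : (counitRight ε).comp (CT.map α.toAlgHom α.toAlgHom) =
      α.toAlgHom.comp (counitRight (ε.comp α.toAlgHom)) := by
    refine CT.algHom_ext (fun a => ?_) fun a => ?_ <;> simp [counitRight, Algebra.ofId_apply]
  have h' := DFunLike.congr_fun h (T : CT A A)
  rwa [AlgHom.comp_apply, AlgHom.comp_apply, ← coe_transferUnit] at h'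

end Twists

end QLorentz

end
-- The four statements assembled
theorem mainTheorem11 :
    (∀ (α' α'' : QLorentz.Uh ≃ₐ[QLorentz.K] QLorentz.U0)
      (F' F'' : (QLorentz.CT QLorentz.U0 QLorentz.U0)ˣ),
      QLorentz.IsTwist QLorentz.U0.comul QLorentz.U0.counit
        (QLorentz.transfer α' QLorentz.Uh.comul) F' →
      QLorentz.IsTwist QLorentz.U0.comul QLorentz.U0.counit
        (QLorentz.transfer α'' QLorentz.Uh.comul) F'' →
      QLorentz.IsTwist
          (QLorentz.CT.comul QLorentz.U0.comul QLorentz.U0.comul)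
          (QLorentz.CT.counit QLorentz.U0.counit QLorentz.U0.counit)
          (QLorentz.transfer (QLorentz.CT.congr α' α'') QLorentz.So4.comul)
          (QLorentz.F13 F' * QLorentz.F24 F'') ∧
        QLorentz.IsTwist
          (QLorentz.CT.comul QLorentz.U0.comul QLorentz.U0.comul)
          (QLorentz.CT.counit QLorentz.U0.counit QLorentz.U0.counit)
          (QLorentz.transfer (QLorentz.CT.congr α' α'') QLorentz.Lorentz.comul)
          ((QLorentz.transferUnit (QLorentz.CT.congr α' α'') QLorentz.So4.R23)⁻¹ *
            (QLorentz.F13 F' * QLorentz.F24 F''))) ∧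
    (∀ (X : Type*) [AddCommGroup X] [Module QLorentz.K X]
      [IsAdicComplete QLorentz.hbarIdeal X] [Module QLorentz.So4 X]
      [IsScalarTower QLorentz.K QLorentz.So4 X] (μ : X →ₗ[QLorentz.K] X →ₗ[QLorentz.K] X),
      (QLorentz.IsModuleAlgebra QLorentz.So4.comul μ →
        QLorentz.IsModuleAlgebra QLorentz.Lorentz.comul
          (QLorentz.twistedMul μ (QLorentz.So4.R23 : QLorentz.CT QLorentz.So4 QLorentz.So4))) ∧
      (∀ one : X, QLorentz.IsModuleUnit QLorentz.So4.counit μ one →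
        QLorentz.IsModuleUnit QLorentz.So4.counit
          (QLorentz.twistedMul μ (QLorentz.So4.R23 : QLorentz.CT QLorentz.So4 QLorentz.So4)) one) ∧
      (∀ s : X → X,
        QLorentz.IsModuleStarAlgebra QLorentz.So4.comul QLorentz.So4.antipode
            QLorentz.So4.flipStar μ s →
          QLorentz.IsModuleStarAlgebra QLorentz.Lorentz.comul QLorentz.Lorentz.antipode
            QLorentz.Lorentz.star
            (QLorentz.twistedMul μ
              (QLorentz.So4.R23 : QLorentz.CT QLorentz.So4 QLorentz.So4)) s)) := by
  refine ⟨fun α' α'' F' F'' hF' hF'' => ?_, fun X _ _ _ _ _ μ => ⟨fun h => ?_, fun one h => ?_, fun s h => ?_⟩⟩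
  · have h := hF'.tensor hF''
    rw [← QLorentz.transfer_comul] at h
    refine ⟨h, ?_⟩
    have hL : QLorentz.Lorentz.comul = QLorentz.conjHom QLorentz.So4.R23⁻¹ QLorentz.So4.comul := rfl
    rw [hL, QLorentz.transfer_conjHom, QLorentz.transferUnit_inv]
    -- The Lorentz twist is the Euclidean one multiplied by the transferred R₂₃⁻¹, whose
    -- normalisation follows from that of R₂₃.
    refine h.mul _ (QLorentz.map_inv_eq_one _ ?_) (QLorentz.map_inv_eq_one _ ?_)
    · rw [QLorentz.counitLeft_transferUnit, QLorentz.So4.counitLeft_R23, map_one]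
    · rw [QLorentz.counitRight_transferUnit, QLorentz.So4.counitRight_R23, map_one]
  · exact h.twist QLorentz.So4.R23 QLorentz.So4.R23_cocycle
  · exact h.twist (QLorentz.So4.counitLeft_R23 _) (QLorentz.So4.counitRight_R23 _)
  · exact QLorentz.lorentz_isModuleStarAlgebra h
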